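/- **Theorem 3.2.** Let $P$ be a probability transition kernel on a measurable space $(\mathcal X,\mathcal F)$. For $x\in\mathcal X$ let $\mathbb P_x$ be the law on $\mathcal X^{\mathbb N_0}$ of the time-homogeneous Markov chain $Y=(Y_n)_{n\ge0}$ with transition kernel $P$ and $Y_0=x$. For a (not necessarily finite) measure $m$ on $\mathcal X$, or on a measurable subset of $\mathcal X$, put $\mathbb P_m:=\int \mathbb P_x(\cdot)\,m(dx)$, and let $\mathbb E_m$ be the integral with respect to $\mathbb P_m$. Let $A\in\mathcal F$ be non-empty, let $\mathcal F_A:=\{B\in\mathcal F: B\subset A\}$, and let $$T_1:=\inf\{k>0:\ Y_{k-1}\in A^c,\ Y_k\in A\}\qquad(\inf\varnothing:=\infty)$$ be the first entrance time into $A$ from $A^c$. The *entrance chain* $Y^{\rangle A}$ is the Markov chain on $A\cup\{\dagger\}$ with transition kernel $P_A^{entr}(x,\cdot):=\mathbb P_x(Y_{T_1}\in\cdot)$ for $x\in A$, where $Y_\infty:=\dagger$, and with $\dagger$ absorbing. We use the following terminology. * A measure $m$ on $\mathcal X$ is *invariant* for $Y$ if $\int P(x,B)\,m(dx)=m(B)$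 for all $B\in\mathcal F$. A measure $\nu$ on $(A,\mathcal F_A)$ is *invariant* for $Y^{\rangle A}$ if $\int_A P_A^{entr}(x,B)\,\nu(dx)=\nu(B)$ for all $B\in\mathcal F_A$. * A measure $\nu$ on $(A,\mathcal F_A)$ is *proper* for $Y^{\rangle A}$ if for $\nu$-a.e. $x\in A$ we have $\mathbb P_x(Y_k\in A\text{ i.o.},\ Y_k\in A^c\text{ i.o.})=1$. * An invariant measure $m$ of a Markov chain $Z$ is *recurrent* if for every measurable set $B$ with $m(B)<\infty$, the chain started at $x$ satisfies $Z_n\in B$ for some $n\ge1$ almost surely, for $m$-a.e. $x\in B$. It is *ergodic* if the shift on the space of sequences is an ergodic measure preserving transformation with respect to the law of $Z$ started under $m$, that is, every shift-invariant measurable set of sequences or its complement has measure zero. For $Z=Y^{\rangle A}$, measures on $A$ are regarded as measures on $A\cup\{\dagger\}$ that do not charge $\dagger$. Let $\nu$ be a measure on $(A,\mathcal F_A)$ that is invariant for $Y^{\rangle A}$ and satisfies $\mathbb P_\nu(T_1=\infty)=0$, and define the measure $$\mu:=\mathbb E_\nu\Big[\sum_{k=0}^{T_1-1}\mathbf 1(Y_k\in\cdot)\Big]\quad\text{on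 }(\mathcal X,\mathcal F).$$ Then: 1. $\nu$ is proper for $Y^{\rangle A}$; 2. $\mu$ is invariant for $Y$; 3. $\nu=\mu_A^{entr}$, where $\mu_A^{entr}(B):=\int_{A^c}P(x,B)\,\mu(dx)$ for $B\in\mathcal F_A$; 4. $\mathbb P_\mu(T_1=\infty)=0$; 5. if $\nu$ is $\sigma$-finite and recurrent for $Y^{\rangle A}$, then $\mu$ is recurrent for $Y$; if, in addition, $\nu$ is ergodic for $Y^{\rangle A}$, then $\mu$ is ergodic for $Y$. -/

import Mathlib

open MeasureTheory ProbabilityTheory Filter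
open scoped ENNReal

namespace EntranceChain

/-! ### Markov chains with a given transition kernel -/

section Chain

variable {E : Type*} [MeasurableSpace E]

/-- `pathKernel P x` is `P_x(Y ∈ ·)`: the law on `E^ℕ` of the time-homogeneous Markov chain `Y` with
transition kernel `P` started at `Y 0 = x` (Ionescu-Tulcea construction). -/
noncomputable def pathKernel (P : Kernel E E) [IsMarkovKernel P] : Kernel E (ℕ → E) :=
  (Kernel.traj (X := fun _ : ℕ => E)
    (fun n => P.comap (fun h : ∀ _ : Finset.Iic n, E => h ⟨n, Finset.mem_Iic.2 le_rfl⟩)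
      (measurable_pi_apply _)) 0).comap
    (fun x _ => x) (measurable_pi_lambda _ fun _ => measurable_id)

/-- `P_m(Y ∈ ·) = ∫ P_x(Y ∈ ·) m(dx)`: the "law" of the chain started under a measure `m`, which
is not necessarily a probability. -/
noncomputable def pathMeasure (P : Kernel E E) [IsMarkovKernel P] (m : Measure E) :
    Measure (ℕ → E) :=
  m.bind (pathKernel P)

/-- The one-sided shift on sequences. -/
def shift (y : ℕ → E) : ℕ → E := fun n => y (n + 1)

/-- Recurrence of an invariant measure `m` of the chain with transition kernel `P`: every measurable
set `B` of finite measure is revisited almost surely from `m`-almost every point of `B`. -/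
def IsRecurrent (P : Kernel E E) [IsMarkovKernel P] (m : Measure E) : Prop :=
  ∀ B : Set E, MeasurableSet B → m B < ∞ →
    ∀ᵐ x ∂m, x ∈ B → pathKernel P x {y | ∃ n : ℕ, 1 ≤ n ∧ y n ∈ B} = 1

/-- Ergodicity of an invariant measure `m` of the chain with transition kernel `P`: the shift is an
ergodic measure preserving transformation of the path space equipped with `P_m(Y ∈ ·)`. -/
def IsErgodic (P : Kernel E E) [IsMarkovKernel P] (m : Measure E) : Prop :=
  Ergodic (shift (E := E)) (pathMeasure P m)

end Chain

/-! ### Entrance times and positions -/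

section Entrance

variable {X : Type*}

/-- The first entrance time `T₁ = inf {k > 0 : y (k - 1) ∈ Aᶜ, y k ∈ A}` into `A` from `Aᶜ`, with
`inf ∅ = ∞`. -/
noncomputable def entranceTime (A : Set X) (y : ℕ → X) : ℕ∞ :=
  ⨅ (k : ℕ) (_ : 0 < k ∧ y (k - 1) ∈ Aᶜ ∧ y k ∈ A), (k : ℕ∞)

theorem le_entranceTime_iff (A : Set X) (y : ℕ → X) (n : ℕ∞) :
    n ≤ entranceTime A y ↔ ∀ k : ℕ, 0 < k ∧ y (k - 1) ∈ Aᶜ ∧ y k ∈ A → n ≤ k := by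
  simp only [entranceTime, le_iInf_iff]

/-- At a finite first entrance time `n` an entrance into `A` takes place. -/
theorem entrance_of_entranceTime_eq {A : Set X} {y : ℕ → X} {n : ℕ} (h : entranceTime A y = n) :
    0 < n ∧ y (n - 1) ∈ Aᶜ ∧ y n ∈ A := by
  by_contra hn
  have h1 : ((n + 1 : ℕ) : ℕ∞) ≤ entranceTime A y := by
    rw [le_entranceTime_iff]
    intro k hk
    have h2 := (le_entranceTime_iff A y n).1 h.ge k hk
    have h3 : n ≠ k := by
      rintro rfl
      exact hn hk
    have h4 : n ≤ k := by exact_mod_cast h2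
    have h5 : n + 1 ≤ k := by omega
    exact_mod_cast h5
  rw [h] at h1
  have h6 : n + 1 ≤ n := by exact_mod_cast h1
  omega

theorem mem_of_entranceTime_ne_top {A : Set X} {y : ℕ → X} (h : entranceTime A y ≠ ⊤) :
    y (entranceTime A y).toNat ∈ A :=
  (entrance_of_entranceTime_eq (ENat.natCast_toNat h).symm).2.2

open scoped Classical in
/-- The first entrance position `y T₁`, an element of `A ∪ {†}`. The cemetery state `†`, attained
when `T₁ = ∞`, is `Sum.inr ()`. -/
noncomputable def entrancePos (A : Set X) (y : ℕ → X) : A ⊕ Unit :=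
  if h : entranceTime A y = ⊤ then Sum.inr ()
  else Sum.inl ⟨y (entranceTime A y).toNat, mem_of_entranceTime_ne_top h⟩

variable [MeasurableSpace X]

theorem measurable_entranceTime {A : Set X} (hA : MeasurableSet A) :
    Measurable (entranceTime A : (ℕ → X) → ℕ∞) := by
  have hle : ∀ n : ℕ∞, MeasurableSet {y : ℕ → X | n ≤ entranceTime A y} := by
    intro n
    have : {y : ℕ → X | n ≤ entranceTime A y} =
        ⋂ k : ℕ, ⋂ _ : ¬ n ≤ k, {y | 0 < k ∧ y (k - 1) ∈ Aᶜ ∧ y k ∈ A}ᶜ := by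
      ext y
      simp only [Set.mem_ofPred_eq, le_entranceTime_iff, Set.mem_iInter, Set.mem_compl_iff]
      exact forall_congr' fun k => by tauto
    rw [this]
    refine MeasurableSet.iInter fun k => MeasurableSet.iInter fun _ => MeasurableSet.compl ?_
    have h1 : MeasurableSet {y : ℕ → X | y (k - 1) ∈ Aᶜ} := measurable_pi_apply (k - 1) hA.compl
    have h2 : MeasurableSet {y : ℕ → X | y k ∈ A} := measurable_pi_apply k hA
    exact (MeasurableSet.const _).inter (h1.inter h2)
  refine measurable_to_countable' fun n => ?_
  have : entranceTime A ⁻¹' {n} =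
      {y : ℕ → X | n ≤ entranceTime A y} \ {y | n < entranceTime A y} := by
    ext y
    simp only [Set.mem_preimage, Set.mem_singleton_iff, Set.mem_sdiff, Set.mem_ofPred_eq, not_lt]
    exact ⟨fun h => ⟨h.ge, h.le⟩, fun h => le_antisymm h.2 h.1⟩
  rw [this]
  refine (hle n).diff ?_
  rcases eq_or_ne n ⊤ with rfl | hn
  · simp
  · have : {y : ℕ → X | n < entranceTime A y} = {y | n + 1 ≤ entranceTime A y} := by
      ext y
      exact (ENat.add_one_le_iff hn).symm
    rw [this]
    exact hle _

theorem measurable_entrancePos {A : Set X} (hA : MeasurableSet A) :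
    Measurable (entrancePos A : (ℕ → X) → A ⊕ Unit) := by
  intro s hs
  have hT := measurable_entranceTime (X := X) hA
  have hs' : MeasurableSet ((↑) '' (Sum.inl ⁻¹' s : Set A) : Set X) :=
    hA.subtype_image (measurable_inl hs)
  have : (entrancePos A ⁻¹' s : Set (ℕ → X)) =
      (entranceTime A ⁻¹' {⊤} ∩ {_y | Sum.inr () ∈ s}) ∪
      ⋃ k : ℕ, entranceTime A ⁻¹' {(k : ℕ∞)} ∩
        (fun y : ℕ → X => y k) ⁻¹' ((↑) '' (Sum.inl ⁻¹' s : Set A)) := by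
    ext y
    by_cases h : entranceTime A y = ⊤
    · simp [entrancePos, h]
    · obtain ⟨n, hn⟩ := ENat.ne_top_iff_exists.1 h
      have hm : y n ∈ A := (entrance_of_entranceTime_eq hn.symm).2.2
      simp [entrancePos, ← hn, hm]
  rw [this]
  refine ((hT (measurableSet_singleton _)).inter (MeasurableSet.const _)).union
    (MeasurableSet.iUnion fun k => (hT (measurableSet_singleton _)).inter
      (measurable_pi_apply k hs'))

/-- The transition kernel on `A ∪ {†}` of the entrance chain into `A`: started at `x ∈ A`, it moves
to the first entrance position of `Y` under `P_x`; the state `†` is absorbing. -/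
noncomputable def entranceKernel (P : Kernel X X) [IsMarkovKernel P] {A : Set X}
    (hA : MeasurableSet A) : Kernel (A ⊕ Unit) (A ⊕ Unit) where
  toFun := Sum.elim (fun x : A => (pathKernel P x).map (entrancePos A))
    (fun _ => Measure.dirac (Sum.inr ()))
  measurable' :=
    ((Measure.measurable_map _ (measurable_entrancePos hA)).comp
      ((pathKernel P).measurable.comp measurable_subtype_coe)).sumElim measurable_const

instance (P : Kernel X X) [IsMarkovKernel P] : IsMarkovKernel (pathKernel P) := by
  unfold pathKernel
  infer_instance

instance (P : Kernel X X) [IsMarkovKernel P] {A : Set X} (hA : MeasurableSet A) :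
    IsMarkovKernel (entranceKernel P hA) := by
  refine ⟨fun x => ?_⟩
  rcases x with x | x
  · exact Measure.isProbabilityMeasure_map (measurable_entrancePos hA).aemeasurable
  · exact Measure.dirac.isProbabilityMeasure

/-- A measure `ν` on `A` is invariant for the entrance chain if
`∫_A P_x(Y_{T₁} ∈ B) ν(dx) = ν(B)` for all measurable `B ⊆ A`. -/
def IsEntranceInvariant (P : Kernel X X) [IsMarkovKernel P] {A : Set X} (hA : MeasurableSet A)
    (ν : Measure A) : Prop :=
  ∀ B : Set A, MeasurableSet B →
    ∫⁻ x, entranceKernel P hA (Sum.inl x) (Sum.inl '' B) ∂ν = ν B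

/-- A measure on `A` regarded as a measure on `A ∪ {†}` which does not charge `†`. -/
noncomputable def withCemetery {A : Set X} (ν : Measure A) : Measure (A ⊕ Unit) :=
  ν.map Sum.inl

/-- `ν` is recurrent for the entrance chain. -/
def IsEntranceRecurrent (P : Kernel X X) [IsMarkovKernel P] {A : Set X} (hA : MeasurableSet A)
    (ν : Measure A) : Prop :=
  IsRecurrent (entranceKernel P hA) (withCemetery ν)

/-- `ν` is ergodic for the entrance chain. -/
def IsEntranceErgodic (P : Kernel X X) [IsMarkovKernel P] {A : Set X} (hA : MeasurableSet A)
    (ν : Measure A) : Prop :=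
  IsErgodic (entranceKernel P hA) (withCemetery ν)

/-- The set of starting points from which `Y` visits both `A` and `Aᶜ` infinitely often, almost
surely. -/
def crossingSet (P : Kernel X X) [IsMarkovKernel P] (A : Set X) : Set X :=
  {x | pathKernel P x {y | (∃ᶠ k in atTop, y k ∈ A) ∧ (∃ᶠ k in atTop, y k ∈ Aᶜ)} = 1}

/-- A measure on `A` is proper for the entrance chain if it does not charge the complement of
`crossingSet P A`. -/
def IsProper (P : Kernel X X) [IsMarkovKernel P] (A : Set X) (ν : Measure A) : Prop :=
  ν {x : A | (x : X) ∉ crossingSet P A} = 0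

/-- `P_ν(Y ∈ ·)` for a measure `ν` on `A`. -/
noncomputable def pathMeasureOn (P : Kernel X X) [IsMarkovKernel P] {A : Set X} (ν : Measure A) :
    Measure (ℕ → X) :=
  pathMeasure P (ν.map (↑))

/-- The entrance measure `∫_{Aᶜ} P(x, ·) μ(dx)` on `A`. -/
noncomputable def entranceMeasure (P : Kernel X X) (A : Set X) (μ : Measure X) : Measure A :=
  ((μ.restrict Aᶜ).bind P).comap (↑)

open scoped Classical in
/-- The number `∑_{k < T₁} 1(y k ∈ B)` of visits of the path `y` to `B` before `T₁`. -/
noncomputable def visits (A B : Set X) (y : ℕ → X) : ℝ≥0∞ :=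
  ∑' k : ℕ, if (k : ℕ∞) < entranceTime A y ∧ y k ∈ B then 1 else 0

theorem measurable_visits {A B : Set X} (hA : MeasurableSet A) (hB : MeasurableSet B) :
    Measurable (visits A B : (ℕ → X) → ℝ≥0∞) := by
  classical
  refine Measurable.tsum fun k => ?_
  refine Measurable.ite ?_ measurable_const measurable_const
  exact (measurable_entranceTime hA (DiscreteMeasurableSpace.forall_measurableSet
    (Set.Ioi (k : ℕ∞)))).inter (measurable_pi_apply k hB)

/-- The measure `E_ν [∑_{k < T₁} 1(Y_k ∈ ·)]` on `X`. -/
noncomputable def occupationMeasure (P : Kernel X X) [IsMarkovKernel P] {A : Set X}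
    (hA : MeasurableSet A) (ν : Measure A) : Measure X :=
  Measure.ofMeasurable (fun B _ => ∫⁻ y, visits A B y ∂(pathMeasureOn P ν))
    (by simp [visits])
    (by
      classical
      intro f hf hd
      rw [← lintegral_tsum fun i => (measurable_visits hA (hf i)).aemeasurable]
      refine lintegral_congr fun y => ?_
      simp only [visits]
      rw [ENNReal.tsum_comm]
      refine tsum_congr fun k => ?_
      by_cases hk : (k : ℕ∞) < entranceTime A y
      · by_cases hy : ∃ i, y k ∈ f i
        · obtain ⟨i, hi⟩ := hy
          rw [tsum_eq_single i]
          · simp [hk, hi, Set.mem_iUnion.2 ⟨i, hi⟩]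
          · intro j hj
            have : y k ∉ f j := fun h => Set.disjoint_left.1 (hd hj) h hi
            simp [this]
        · push Not at hy
          simp [hy]
      · simp [hk])

theorem occupationMeasure_apply (P : Kernel X X) [IsMarkovKernel P] {A : Set X}
    (hA : MeasurableSet A) (ν : Measure A) {B : Set X} (hB : MeasurableSet B) :
    occupationMeasure P hA ν B = ∫⁻ y, visits A B y ∂(pathMeasureOn P ν) :=
  Measure.ofMeasurable_apply B hB

end Entrance

end EntranceChain

open EntranceChain

/-! Write `ρ` for the path law `P_ν` and `S` for `entranceShift A`, the map that restarts a path at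
`T₁`. The strong Markov property (`pathKernel_entranceShift`) and the invariance of `ν` show that
`S` preserves `ρ` (`measurePreserving_entranceShift`). Since `{k < T₁}` is known at time `k`, the
Markov property turns `P_μ` into a Kakutani tower over `ρ` of height `T₁`: `P_μ(F) = ∑ k, ρ(k < T₁,
shift^k ∈ F)` (`pathMeasure_occupationMeasure`). The shift climbs the tower and, at the top, drops
to the base through `S`. It therefore preserves `P_μ`, which gives the invariance of `μ`. Iterating
`S` gives infinitely many entrances, hence properness. The paths with `y 0 ∈ Aᶜ`, `y 1 ∈ C` are the
tops of the tower that `S` sends into `C`, so their measure is `ν C`; this identifies `ν` as the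
entrance measure. Null sets pass from `ρ` to `P_μ` level by level.

Recurrence of `μ`: recurrence of `ν` and `σ`-finiteness make almost every path enter `A` infinitely
often through one set `C` with `ν C < ∞`. The paths that start in `B` and never return form a
wandering set `D`. Its disjoint preimages bound the expected number of entrances through `C` from
`D` by `ν C`, so on `D` there are only finitely many of them, and `D` is null.

Ergodicity of `μ`: for a shift-invariant event `F`, Lévy's 0-1 law gives `P_{Y_n}(F) → 1_F`, while
recurrence brings the chain back infinitely often to level sets of `x ↦ P_x(F)`. Hence `P_x(F)` is
`0` or `1` for `ν`-a.e. `x`, so under `ρ` the event `F` amounts to starting in `C = {P_x(F) = 1}`.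
As `F` is unaffected by `S`, the set `C` is invariant for the entrance chain. Ergodicity of `ν`
makes `C` null or conull, and the tower carries this to `F`. -/

namespace EntranceChain

/-! ### Path laws and the Markov property at a fixed time -/

section Markov

variable {E : Type*} [MeasurableSpace E]

theorem measurable_shift : Measurable (shift (E := E)) :=
  measurable_pi_lambda _ fun n => measurable_pi_apply (n + 1)

theorem iterate_shift_apply {E : Type*} (k : ℕ) (y : ℕ → E) (n : ℕ) : shift^[k] y n = y (n + k) := by
  induction k generalizing n with
  | zero => rfl
  | succ k ih =>
    rw [Function.iterate_succ_apply', shift, ih]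
    congr 1
    omega

theorem measurable_iterate_shift (k : ℕ) : Measurable (shift^[k] : (ℕ → E) → ℕ → E) :=
  measurable_shift.iterate k

/-- Finite measures on the sequence space are determined by initial rectangles. -/
theorem ext_of_rectangles {μ ν : Measure (ℕ → E)} [IsFiniteMeasure μ]
    (h : ∀ (n : ℕ) (t : ℕ → Set E), (∀ i, MeasurableSet (t i)) →
      μ {y | ∀ i < n, y i ∈ t i} = ν {y | ∀ i < n, y i ∈ t i}) : μ = ν := by
  classical
  refine ext_of_generate_finite _ generateFrom_squareCylinders.symm
    (isPiSystem_squareCylinders (fun _ => MeasurableSpace.isPiSystem_measurableSet)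
      fun _ => MeasurableSet.univ) ?_ ?_
  · rintro _ ⟨s, t, ht, rfl⟩
    -- A cylinder over a finite set of times is an initial rectangle once the unconstrained times
    -- are padded with `Set.univ`.
    have hs : ((s : Set ℕ).pi t) = {y : ℕ → E | ∀ i < s.sup id + 1,
        y i ∈ (if i ∈ s then t i else Set.univ)} := by
      ext y
      simp only [Set.mem_pi, Finset.mem_coe, Set.mem_ofPred_eq]
      constructor
      · intro hy i _
        split_ifs with his
        · exact hy i his
        · trivial
      · intro hy i his
        have := hy i (Nat.lt_succ_of_le (Finset.le_sup (f := id) his))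
        simpa [his] using this
    rw [hs]
    refine h _ _ fun i => ?_
    split_ifs
    · exact ht i trivial
    · exact MeasurableSet.univ
  · simpa using h 0 (fun _ => Set.univ) fun _ => MeasurableSet.univ

variable (P : Kernel E E)

/-- The probability that the chain started at `x` stays in `t i` at each time `i < m`. -/
noncomputable def rectangleProb : ℕ → (ℕ → Set E) → E → ℝ≥0∞
  | 0, _, _ => 1
  | m + 1, t, x => (t 0).indicator
      (fun x => ∫⁻ z, rectangleProb m (fun i => t (i + 1)) z ∂(P x)) x

theorem measurable_rectangleProb (m : ℕ) (t : ℕ → Set E) (ht : ∀ i, MeasurableSet (t i)) :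
    Measurable (rectangleProb P m t) := by
  induction m generalizing t with
  | zero => exact measurable_const
  | succ m ih =>
    exact ((ih _ fun i => ht (i + 1)).lintegral_kernel).indicator (ht 0)

variable [IsMarkovKernel P]

/-- The transition kernel from the history up to time `n` to the state at time `n + 1`. -/
noncomputable def historyKernel (n : ℕ) : Kernel (∀ _ : Finset.Iic n, E) E :=
  P.comap (fun h : ∀ _ : Finset.Iic n, E => h ⟨n, Finset.mem_Iic.2 le_rfl⟩)
    (measurable_pi_apply _)

instance (n : ℕ) : IsMarkovKernel (historyKernel P n) := by
  unfold historyKernel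
  infer_instance

theorem pathKernel_apply (x : E) :
    pathKernel P x = Kernel.traj (X := fun _ : ℕ => E) (historyKernel P) 0 (fun _ => x) := rfl

/-- A trajectory continuing the history `h` agrees with `h` almost surely at time `k`, so a
condition on that coordinate is deterministic. -/
theorem traj_ae_eq (k : ℕ) (h : ∀ _ : Finset.Iic k, E) {S : Set E} (hS : MeasurableSet S)
    (F : Set (ℕ → E)) :
    Kernel.traj (X := fun _ : ℕ => E) (historyKernel P) k h ({y | y k ∈ S} ∩ F) =
      S.indicator (fun _ => Kernel.traj (X := fun _ : ℕ => E) (historyKernel P) k h F)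
        (h ⟨k, Finset.mem_Iic.2 le_rfl⟩) := by
  have h1 : (Kernel.traj (X := fun _ : ℕ => E) (historyKernel P) k h).map (fun y => y k) =
      Measure.dirac (h ⟨k, Finset.mem_Iic.2 le_rfl⟩) := by
    have h2 := Kernel.traj_map_frestrictLe_of_le (X := fun _ : ℕ => E)
      (κ := historyKernel P) (le_refl k)
    have h3 := congrArg (fun K => (K h).map fun g => g ⟨k, Finset.mem_Iic.2 le_rfl⟩) h2
    rw [Kernel.map_apply _ (by fun_prop), Measure.map_map (by fun_prop) (by fun_prop),
      Kernel.deterministic_apply] at h3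
    exact h3.trans (Measure.map_dirac' (α := ∀ _ : Finset.Iic k, E) (measurable_pi_apply _) _)
  have h4 : ∀ S : Set E, MeasurableSet S → h ⟨k, Finset.mem_Iic.2 le_rfl⟩ ∈ S →
      ∀ᵐ y ∂(Kernel.traj (X := fun _ : ℕ => E) (historyKernel P) k h), y k ∈ S := by
    intro S hS hh
    have : ∀ᵐ x ∂(Kernel.traj (X := fun _ : ℕ => E) (historyKernel P) k h).map
        (fun y => y k), x ∈ S := by
      rw [h1]
      exact (ae_dirac_iff (p := fun x => x ∈ S) hS).2 hh
    exact ae_of_ae_map (measurable_pi_apply k).aemeasurable this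
  by_cases hh : h ⟨k, Finset.mem_Iic.2 le_rfl⟩ ∈ S
  · rw [Set.indicator_of_mem hh]
    refine measure_congr ?_
    filter_upwards [h4 S hS hh] with y hy
    exact propext ⟨fun h => h.2, fun h => ⟨hy, h⟩⟩
  · rw [Set.indicator_of_notMem hh]
    have := h4 Sᶜ hS.compl hh
    refine measure_mono_null ?_ (ae_iff.1 this)
    intro y hy
    simpa using hy.1

theorem lintegral_partialTraj_succ (k : ℕ) (h : ∀ _ : Finset.Iic k, E) {f : E → ℝ≥0∞}
    (hf : Measurable f) :
    ∫⁻ g, f (g ⟨k + 1, Finset.mem_Iic.2 le_rfl⟩)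
      ∂(Kernel.partialTraj (X := fun _ : ℕ => E) (historyKernel P) k (k + 1) h) =
      ∫⁻ z, f z ∂(P (h ⟨k, Finset.mem_Iic.2 le_rfl⟩)) := by
  have h1 := congrArg (fun K => K h) (Kernel.map_partialTraj_succ_self (X := fun _ : ℕ => E)
    (κ := historyKernel P) k)
  rw [Kernel.map_apply _ (by fun_prop)] at h1
  have h2 : historyKernel P k h = P (h ⟨k, Finset.mem_Iic.2 le_rfl⟩) := rfl
  rw [← h2, ← h1, lintegral_map hf (by fun_prop)]

theorem measurableSet_rectangle (m : ℕ) (t : ℕ → Set E) (ht : ∀ i, MeasurableSet (t i)) (k : ℕ) :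
    MeasurableSet {y : ℕ → E | ∀ i < m, y (i + k) ∈ t i} := by
  have : {y : ℕ → E | ∀ i < m, y (i + k) ∈ t i} =
      ⋂ i : ℕ, ⋂ _ : i < m, (fun y : ℕ → E => y (i + k)) ⁻¹' t i := by
    ext y; simp
  rw [this]
  exact MeasurableSet.iInter fun i => MeasurableSet.iInter fun _ =>
    measurable_pi_apply (i + k) (ht i)

/-- The right-hand side involves only the last state of the history, and neither `k` nor the earlier
states. This is the Markov property on rectangles, proved by peeling off one coordinate at a time.
-/
theorem traj_rectangle (m : ℕ) (t : ℕ → Set E) (ht : ∀ i, MeasurableSet (t i)) (k : ℕ)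
    (h : ∀ _ : Finset.Iic k, E) :
    Kernel.traj (X := fun _ : ℕ => E) (historyKernel P) k h {y | ∀ i < m, y (i + k) ∈ t i} =
      rectangleProb P m t (h ⟨k, Finset.mem_Iic.2 le_rfl⟩) := by
  induction m generalizing t k with
  | zero => simp [rectangleProb]
  | succ m ih =>
    have h1 : {y : ℕ → E | ∀ i < m + 1, y (i + k) ∈ t i} =
        {y | y k ∈ t 0} ∩ {y | ∀ i < m, y (i + (k + 1)) ∈ t (i + 1)} := by
      ext y
      simp only [Set.mem_ofPred_eq, Set.mem_inter_iff]
      constructor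
      · intro hy
        refine ⟨by simpa using hy 0 (by omega), fun i hi => ?_⟩
        have := hy (i + 1) (by omega)
        rwa [add_assoc, add_comm 1 k] at this
      · rintro ⟨h0, hy⟩ i hi
        rcases i with _ | i
        · simpa using h0
        · have := hy i (by omega)
          rwa [add_assoc, add_comm 1 k]
    have hm := measurableSet_rectangle m (fun i => t (i + 1)) (fun i => ht (i + 1)) (k + 1)
    rw [h1, traj_ae_eq P k h (ht 0), rectangleProb]
    by_cases hh : h ⟨k, Finset.mem_Iic.2 le_rfl⟩ ∈ t 0
    · rw [Set.indicator_of_mem hh, Set.indicator_of_mem hh,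
        ← Kernel.traj_comp_partialTraj (Nat.le_succ k), Kernel.comp_apply' _ _ _ hm]
      simp_rw [ih (fun i => t (i + 1)) (fun i => ht (i + 1)) (k + 1)]
      exact lintegral_partialTraj_succ P k h
        (measurable_rectangleProb P m _ fun i => ht (i + 1))
    · rw [Set.indicator_of_notMem hh, Set.indicator_of_notMem hh]

/-- The future of the chain after time `k`, given its history up to time `k`, is distributed as the
chain started at the present state. -/
theorem traj_map_shift (k : ℕ) (h : ∀ _ : Finset.Iic k, E) :
    (Kernel.traj (X := fun _ : ℕ => E) (historyKernel P) k h).map shift^[k] =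
      pathKernel P (h ⟨k, Finset.mem_Iic.2 le_rfl⟩) := by
  have := (Measure.isProbabilityMeasure_map
    (μ := Kernel.traj (X := fun _ : ℕ => E) (historyKernel P) k h)
    (measurable_iterate_shift k).aemeasurable)
  refine ext_of_rectangles fun n t ht => ?_
  have hm := measurableSet_rectangle n t ht 0
  simp only [add_zero] at hm
  rw [Measure.map_apply (measurable_iterate_shift k) hm, pathKernel_apply]
  have h1 := traj_rectangle P n t ht 0 fun _ => h ⟨k, Finset.mem_Iic.2 le_rfl⟩
  simp only [add_zero] at h1
  rw [h1, ← traj_rectangle P n t ht k h]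
  congr 1
  ext y
  simp [iterate_shift_apply]

/-- The Markov property of the chain at a fixed time. -/
theorem pathKernel_inter_shift (x : E) (k : ℕ) {G : Set (ℕ → E)}
    (hG : MeasurableSet[Filtration.piLE (X := fun _ : ℕ => E) k] G) {F : Set (ℕ → E)}
    (hF : MeasurableSet F) :
    pathKernel P x (G ∩ shift^[k] ⁻¹' F) = ∫⁻ y in G, pathKernel P (y k) F ∂(pathKernel P x) := by
  classical
  have hG0 : MeasurableSet G := Filtration.piLE.le k _ hG
  rw [Filtration.piLE_eq_comap_frestrictLe] at hG
  obtain ⟨G', hG', rfl⟩ := hG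
  set g : (∀ _ : Finset.Iic k, E) → ℝ≥0∞ :=
    G'.indicator fun h => pathKernel P (h ⟨k, Finset.mem_Iic.2 le_rfl⟩) F with hg
  have hgm : Measurable g :=
    (((pathKernel P).measurable_coe hF).comp (measurable_pi_apply _)).indicator hG'
  have hR : ∫⁻ y in Preorder.frestrictLe k ⁻¹' G', pathKernel P (y k) F ∂(pathKernel P x) =
      ∫⁻ h, g h ∂(Kernel.partialTraj (X := fun _ : ℕ => E) (historyKernel P) 0 k fun _ => x) := by
    rw [← Kernel.traj_map_frestrictLe_apply, lintegral_map hgm (by fun_prop),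
      ← lintegral_indicator hG0]
    rfl
  have hS : MeasurableSet (shift^[k] ⁻¹' F) := measurable_iterate_shift k hF
  -- Disintegration at time `k`: `G` depends only on the history `h`, and the future given `h` is
  -- the chain started at its last state.
  rw [hR, pathKernel_apply, ← Kernel.traj_comp_partialTraj (Nat.zero_le k),
    Kernel.comp_apply' _ _ _ (hG0.inter hS)]
  refine lintegral_congr fun h => ?_
  have h2 : Kernel.traj (X := fun _ : ℕ => E) (historyKernel P) k h (shift^[k] ⁻¹' F) =
      pathKernel P (h ⟨k, Finset.mem_Iic.2 le_rfl⟩) F := by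
    rw [← traj_map_shift, Measure.map_apply (measurable_iterate_shift k) hF]
  have h3 : ∀ G'' : Set (∀ _ : Finset.Iic k, E), MeasurableSet G'' → h ∈ G'' →
      ∀ᵐ y ∂(Kernel.traj (X := fun _ : ℕ => E) (historyKernel P) k h),
        Preorder.frestrictLe (π := fun _ : ℕ => E) k y ∈ G'' := by
    intro G'' hG'' hh
    refine ae_of_ae_map (f := Preorder.frestrictLe (π := fun _ : ℕ => E) k)
      (p := fun z => z ∈ G'') (by fun_prop) ?_
    have h4 := congrArg (fun K => K h) (Kernel.traj_map_frestrictLe_of_le (X := fun _ : ℕ => E)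
      (κ := historyKernel P) (le_refl k))
    rw [Kernel.map_apply _ (by fun_prop), Kernel.deterministic_apply] at h4
    rw [h4]
    exact (ae_dirac_iff (p := fun z => z ∈ G'') hG'').2 hh
  by_cases hh : h ∈ G'
  · rw [hg, Set.indicator_of_mem hh, ← h2]
    refine measure_congr ?_
    filter_upwards [h3 G' hG' hh] with y hy
    exact propext ⟨fun h => h.2, fun h => ⟨hy, h⟩⟩
  · rw [hg, Set.indicator_of_notMem hh]
    refine measure_mono_null ?_ (ae_iff.1 (h3 G'ᶜ hG'.compl hh))
    intro y hy
    simpa using hy.1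

/-- The chain started at `x` is at `x` at time `0`. -/
theorem pathKernel_inter_zero (x : E) {S : Set E} (hS : MeasurableSet S) (F : Set (ℕ → E)) :
    pathKernel P x ({y | y 0 ∈ S} ∩ F) = S.indicator (fun x => pathKernel P x F) x := by
  rw [pathKernel_apply, traj_ae_eq P 0 _ hS]
  by_cases hx : x ∈ S
  · rw [Set.indicator_of_mem hx, Set.indicator_of_mem hx, pathKernel_apply]
  · rw [Set.indicator_of_notMem hx, Set.indicator_of_notMem hx]

theorem pathKernel_map_one (x : E) : (pathKernel P x).map (fun y => y 1) = P x := by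
  have h1 := congrArg (fun K => K fun _ => x) (Kernel.map_traj_succ_self (X := fun _ : ℕ => E)
    (κ := historyKernel P) (a := 0))
  rw [Kernel.map_apply _ (by fun_prop)] at h1
  exact h1

theorem pathKernel_shift (x : E) {F : Set (ℕ → E)} (hF : MeasurableSet F) :
    pathKernel P x (shift ⁻¹' F) = ∫⁻ z, pathKernel P z F ∂(P x) := by
  have h := pathKernel_inter_shift P x 1 (G := Set.univ) MeasurableSet.univ hF
  rw [Set.univ_inter, Measure.restrict_univ] at h
  rw [← pathKernel_map_one P x, lintegral_map ((pathKernel P).measurable_coe hF) (by fun_prop)]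
  exact h

theorem pathMeasure_apply (m : Measure E) {F : Set (ℕ → E)} (hF : MeasurableSet F) :
    pathMeasure P m F = ∫⁻ x, pathKernel P x F ∂m :=
  Measure.bind_apply hF (pathKernel P).aemeasurable

theorem pathMeasure_inter_shift (m : Measure E) (k : ℕ) {G : Set (ℕ → E)}
    (hG : MeasurableSet[Filtration.piLE (X := fun _ : ℕ => E) k] G) {F : Set (ℕ → E)}
    (hF : MeasurableSet F) :
    pathMeasure P m (G ∩ shift^[k] ⁻¹' F) = ∫⁻ y in G, pathKernel P (y k) F ∂(pathMeasure P m) := by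
  have hG0 : MeasurableSet G := Filtration.piLE.le k _ hG
  have hm : Measurable fun y : ℕ → E => pathKernel P (y k) F :=
    ((pathKernel P).measurable_coe hF).comp (measurable_pi_apply k)
  rw [pathMeasure_apply P m (hG0.inter (measurable_iterate_shift k hF)), ← lintegral_indicator hG0,
    pathMeasure, Measure.lintegral_bind (pathKernel P).aemeasurable (hm.indicator hG0).aemeasurable]
  refine lintegral_congr fun x => ?_
  rw [pathKernel_inter_shift P x k hG hF, lintegral_indicator hG0]

theorem pathMeasure_inter_zero (m : Measure E) {S : Set E} (hS : MeasurableSet S)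
    {F : Set (ℕ → E)} (hF : MeasurableSet F) :
    pathMeasure P m ({y | y 0 ∈ S} ∩ F) = ∫⁻ x in S, pathKernel P x F ∂m := by
  have h0 : MeasurableSet {y : ℕ → E | y 0 ∈ S} := measurable_pi_apply 0 hS
  rw [pathMeasure_apply P m (h0.inter hF), ← lintegral_indicator hS]
  exact lintegral_congr fun x => pathKernel_inter_zero P x hS F

theorem pathMeasure_zero (m : Measure E) {S : Set E} (hS : MeasurableSet S) :
    pathMeasure P m {y | y 0 ∈ S} = m S := by
  have h := pathMeasure_inter_zero P m hS MeasurableSet.univ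
  simpa using h

end Markov

/-! ### The first entrance time and the strong Markov property -/

section EntranceShift

variable {X : Type*}

/-- The path `y` enters `A` from `Aᶜ` at time `k`. -/
def IsEntrance (A : Set X) (y : ℕ → X) (k : ℕ) : Prop :=
  0 < k ∧ y (k - 1) ∈ Aᶜ ∧ y k ∈ A

theorem lt_entranceTime_iff {A : Set X} {y : ℕ → X} {k : ℕ} :
    (k : ℕ∞) < entranceTime A y ↔ ∀ j ≤ k, ¬ IsEntrance A y j := by
  rw [← ENat.add_one_le_iff (ENat.natCast_ne_top k), le_entranceTime_iff]
  constructor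
  · intro h j hj he
    have h1 := h j he
    have h2 : k + 1 ≤ j := by exact_mod_cast h1
    omega
  · intro h j he
    have h1 : k + 1 ≤ j := by
      by_contra hj
      exact h j (by omega) he
    exact_mod_cast h1

theorem IsEntrance.entranceTime_le {A : Set X} {y : ℕ → X} {k : ℕ} (h : IsEntrance A y k) :
    entranceTime A y ≤ k := by
  by_contra hk
  exact lt_entranceTime_iff.1 (not_le.1 hk) k le_rfl h

theorem entranceTime_eq_iff {A : Set X} {y : ℕ → X} {k : ℕ} :
    entranceTime A y = k ↔ IsEntrance A y k ∧ ∀ j < k, ¬ IsEntrance A y j := by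
  constructor
  · intro h
    refine ⟨entrance_of_entranceTime_eq h, fun j hj he => ?_⟩
    have h1 := he.entranceTime_le
    rw [h] at h1
    have : k ≤ j := by exact_mod_cast h1
    omega
  · rintro ⟨h, hj⟩
    obtain ⟨n, hn⟩ := ENat.ne_top_iff_exists.1 (ne_top_of_le_ne_top (ENat.natCast_ne_top k)
      h.entranceTime_le)
    have hn' : IsEntrance A y n := entrance_of_entranceTime_eq hn.symm
    have h1 := h.entranceTime_le
    rw [← hn] at h1 ⊢
    have h2 : n ≤ k := by exact_mod_cast h1
    have h3 : ¬ n < k := fun h => hj n h hn'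
    congr
    omega

theorem entranceTime_pos (A : Set X) (y : ℕ → X) : 0 < entranceTime A y := by
  have := lt_entranceTime_iff (A := A) (y := y) (k := 0)
  rw [Nat.cast_zero] at this
  rw [this]
  intro j hj he
  have := he.1
  omega

theorem IsEntrance.shift {A : Set X} {y : ℕ → X} {k n : ℕ} (h : IsEntrance A y n) (hk : k < n) :
    IsEntrance A (shift^[k] y) (n - k) := by
  obtain ⟨h0, h1, h2⟩ := h
  refine ⟨by omega, ?_, ?_⟩
  · rw [iterate_shift_apply]
    convert h1 using 2
    omega
  · rw [iterate_shift_apply]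
    convert h2 using 2
    omega

theorem entranceTime_shift_ne_top {A : Set X} {y : ℕ → X} {k : ℕ} (h : entranceTime A y ≠ ⊤)
    (hk : (k : ℕ∞) < entranceTime A y) : entranceTime A (shift^[k] y) ≠ ⊤ := by
  obtain ⟨n, hn⟩ := ENat.ne_top_iff_exists.1 h
  rw [← hn] at hk
  have he : IsEntrance A y n := entrance_of_entranceTime_eq hn.symm
  exact ne_top_of_le_ne_top (ENat.natCast_ne_top _) (he.shift (by exact_mod_cast hk)).entranceTime_le

/-- The path seen from its first entrance time on. -/
noncomputable def entranceShift (A : Set X) (y : ℕ → X) : ℕ → X :=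
  shift^[(entranceTime A y).toNat] y

theorem entranceShift_of_eq {A : Set X} {y : ℕ → X} {k : ℕ} (h : entranceTime A y = k) :
    entranceShift A y = shift^[k] y := by
  rw [entranceShift, h, ENat.toNat_natCast]

/-- As long as all entrance times are finite, the path seen from the `n`-th entrance on is the path
seen from some entrance time `k ≥ n` on. -/
theorem exists_iterate_entranceShift {A : Set X} {y : ℕ → X}
    (h : ∀ n, entranceTime A ((entranceShift A)^[n] y) ≠ ⊤) (n : ℕ) :
    ∃ k, n + 1 ≤ k ∧ (entranceShift A)^[n + 1] y = shift^[k] y ∧ IsEntrance A y k := by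
  -- Each application of `entranceShift` adds a positive finite `m` to the accumulated shift `j`;
  -- this keeps the shift at least as large as the number of entrances.
  have key : ∀ n j, (entranceShift A)^[n] y = shift^[j] y → n ≤ j →
      ∃ k, n + 1 ≤ k ∧ (entranceShift A)^[n + 1] y = shift^[k] y ∧ IsEntrance A y k := by
    intro n j hj hnj
    obtain ⟨m, hm⟩ := ENat.ne_top_iff_exists.1 (h n)
    have he : IsEntrance A ((entranceShift A)^[n] y) m := entrance_of_entranceTime_eq hm.symm
    obtain ⟨h0, h1, h2⟩ := he
    refine ⟨m + j, by omega, ?_, by omega, ?_, ?_⟩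
    · rw [Function.iterate_succ_apply', entranceShift_of_eq hm.symm, hj,
        ← Function.iterate_add_apply]
    · rw [hj, iterate_shift_apply] at h1
      convert h1 using 2
      omega
    · rwa [hj, iterate_shift_apply] at h2
  induction n with
  | zero => exact key 0 0 rfl le_rfl
  | succ n ih =>
    obtain ⟨k, hk, hk1, -⟩ := ih
    exact key (n + 1) k hk1 hk

theorem entrancePos_of_eq {A : Set X} {y : ℕ → X} {k : ℕ} (h : entranceTime A y = k) :
    ∃ hm : y k ∈ A, entrancePos A y = Sum.inl ⟨y k, hm⟩ := by
  have hm := (entrance_of_entranceTime_eq h).2.2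
  refine ⟨hm, ?_⟩
  have h' : entranceTime A y ≠ ⊤ := h ▸ ENat.natCast_ne_top k
  simp only [entrancePos, h', dite_false, Sum.inl.injEq, Subtype.mk.injEq]
  rw [h, ENat.toNat_natCast]

theorem entrancePos_of_eq_top {A : Set X} {y : ℕ → X} (h : entranceTime A y = ⊤) :
    entrancePos A y = Sum.inr () := by
  simp [entrancePos, h]

variable [MeasurableSpace X]

theorem measurable_entranceShift {A : Set X} (hA : MeasurableSet A) :
    Measurable (entranceShift A) := by
  -- A shift by a random integer is jointly measurable because the integer ranges over a countable
  -- set.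
  have h1 : Measurable fun p : ℕ × (ℕ → X) => shift^[p.1] p.2 :=
    measurable_from_prod_countable_right fun k => measurable_iterate_shift k
  have h2 : Measurable fun y : ℕ → X => (entranceTime A y).toNat :=
    (measurable_from_top (f := ENat.toNat)).comp (measurable_entranceTime hA)
  exact h1.comp (h2.prodMk measurable_id)

theorem measurableSet_piLE_coord {B : Set X} (hB : MeasurableSet B) {j k : ℕ} (hj : j ≤ k) :
    MeasurableSet[Filtration.piLE (X := fun _ : ℕ => X) k] {y : ℕ → X | y j ∈ B} := by
  rw [Filtration.piLE_eq_comap_frestrictLe]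
  exact ⟨{h | h ⟨j, Finset.mem_Iic.2 hj⟩ ∈ B}, measurable_pi_apply _ hB, rfl⟩

theorem measurableSet_piLE_isEntrance {A : Set X} (hA : MeasurableSet A) {j k : ℕ} (hj : j ≤ k) :
    MeasurableSet[Filtration.piLE (X := fun _ : ℕ => X) k] {y : ℕ → X | IsEntrance A y j} :=
  (MeasurableSet.const _).inter ((measurableSet_piLE_coord hA.compl (by omega)).inter
    (measurableSet_piLE_coord hA hj))

theorem measurableSet_piLE_lt_entranceTime {A : Set X} (hA : MeasurableSet A) (k : ℕ) :
    MeasurableSet[Filtration.piLE (X := fun _ : ℕ => X) k]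
      {y : ℕ → X | (k : ℕ∞) < entranceTime A y} := by
  have : {y : ℕ → X | (k : ℕ∞) < entranceTime A y} =
      ⋂ j : ℕ, ⋂ _ : j ≤ k, {y | IsEntrance A y j}ᶜ := by
    ext y
    simp [lt_entranceTime_iff]
  rw [this]
  exact MeasurableSet.iInter fun j => MeasurableSet.iInter fun hj =>
    (measurableSet_piLE_isEntrance hA hj).compl

theorem measurableSet_piLE_entranceTime_eq {A : Set X} (hA : MeasurableSet A) (k : ℕ) :
    MeasurableSet[Filtration.piLE (X := fun _ : ℕ => X) k]
      {y : ℕ → X | entranceTime A y = k} := by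
  have : {y : ℕ → X | entranceTime A y = k} =
      {y | IsEntrance A y k} ∩ ⋂ j : ℕ, ⋂ _ : j < k, {y | IsEntrance A y j}ᶜ := by
    ext y
    simp [entranceTime_eq_iff]
  rw [this]
  exact (measurableSet_piLE_isEntrance hA le_rfl).inter
    (MeasurableSet.iInter fun j => MeasurableSet.iInter fun hj =>
      (measurableSet_piLE_isEntrance hA hj.le).compl)

theorem measurableSet_lt_entranceTime {A : Set X} (hA : MeasurableSet A) (k : ℕ) :
    MeasurableSet {y : ℕ → X | (k : ℕ∞) < entranceTime A y} :=
  Filtration.piLE.le k _ (measurableSet_piLE_lt_entranceTime hA k)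

theorem measurableSet_entranceTime_eq {A : Set X} (hA : MeasurableSet A) (k : ℕ) :
    MeasurableSet {y : ℕ → X | entranceTime A y = k} :=
  Filtration.piLE.le k _ (measurableSet_piLE_entranceTime_eq hA k)

theorem measurableSet_entranceTime_eq_top {A : Set X} (hA : MeasurableSet A) :
    MeasurableSet {y : ℕ → X | entranceTime A y = ⊤} :=
  measurable_entranceTime hA (measurableSet_singleton _)

/-- Decomposition of an event at the first entrance time according to the value of that time. -/
theorem measure_entranceShift {A : Set X} (hA : MeasurableSet A) (ρ : Measure (ℕ → X))
    {F : Set (ℕ → X)} (hF : MeasurableSet F) :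
    ρ ({y | entranceTime A y ≠ ⊤} ∩ entranceShift A ⁻¹' F) =
      ∑' k : ℕ, ρ ({y | entranceTime A y = k} ∩ shift^[k] ⁻¹' F) := by
  rw [← measure_iUnion]
  · congr 1
    ext y
    simp only [Set.mem_inter_iff, Set.mem_ofPred_eq, Set.mem_preimage, Set.mem_iUnion]
    constructor
    · rintro ⟨h, hy⟩
      obtain ⟨k, hk⟩ := ENat.ne_top_iff_exists.1 h
      exact ⟨k, hk.symm, entranceShift_of_eq hk.symm ▸ hy⟩
    · rintro ⟨k, hk, hy⟩
      exact ⟨hk ▸ ENat.natCast_ne_top k, (entranceShift_of_eq hk).symm ▸ hy⟩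
  · intro i j hij
    refine Set.disjoint_left.2 fun y hi hj => hij ?_
    have h1 : (i : ℕ∞) = j := hi.1.symm.trans hj.1
    exact_mod_cast h1
  · exact fun k => (measurableSet_entranceTime_eq hA k).inter (measurable_iterate_shift k hF)

theorem measure_preimage_entranceShift {A : Set X} (hA : MeasurableSet A) {ρ : Measure (ℕ → X)}
    (hT : ρ {y | entranceTime A y = ⊤} = 0) {F : Set (ℕ → X)} (hF : MeasurableSet F) :
    ρ (entranceShift A ⁻¹' F) =
      ∑' k : ℕ, ρ ({y | entranceTime A y = (k + 1 : ℕ)} ∩ shift^[k + 1] ⁻¹' F) := by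
  -- On `T₁ = ⊤` the map `entranceShift` is the identity, because `ENat.toNat ⊤ = 0`. That set is
  -- null and can be dropped.
  have h1 : ρ (entranceShift A ⁻¹' F) =
      ρ ({y | entranceTime A y ≠ ⊤} ∩ entranceShift A ⁻¹' F) := by
    refine measure_congr ?_
    filter_upwards [measure_eq_zero_iff_ae_notMem.1 hT] with y hy
    exact propext ⟨fun h => ⟨hy, h⟩, fun h => h.2⟩
  have h2 : ρ ({y | entranceTime A y = (0 : ℕ)} ∩ shift^[0] ⁻¹' F) = 0 := by
    refine measure_mono_null (t := ∅) ?_ measure_empty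
    rintro y ⟨hy, -⟩
    have h3 := entranceTime_pos A y
    rw [show entranceTime A y = (0 : ℕ) from hy] at h3
    exact absurd h3 (by simp)
  rw [h1, measure_entranceShift hA ρ hF, tsum_eq_zero_add' ENNReal.summable, h2, zero_add]

variable (P : Kernel X X) [IsMarkovKernel P]

/-- The strong Markov property at the first entrance time. -/
theorem pathKernel_entranceShift {A : Set X} (hA : MeasurableSet A) (x : A) {F : Set (ℕ → X)}
    (hF : MeasurableSet F) :
    pathKernel P x ({y | entranceTime A y ≠ ⊤} ∩ entranceShift A ⁻¹' F) =
      ∫⁻ z, Sum.elim (fun a : A => pathKernel P a F) (fun _ => 0) z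
        ∂(entranceKernel P hA (Sum.inl x)) := by
  have hm : Measurable (Sum.elim (fun a : A => pathKernel P a F) (fun _ : Unit => (0 : ℝ≥0∞))) :=
    (((pathKernel P).measurable_coe hF).comp measurable_subtype_coe).sumElim measurable_const
  have hQ : entranceKernel P hA (Sum.inl x) = (pathKernel P x).map (entrancePos A) := rfl
  have hmk : ∀ k : ℕ, Measurable fun y : ℕ → X => pathKernel P (y k) F := fun k =>
    ((pathKernel P).measurable_coe hF).comp (measurable_pi_apply k)
  rw [measure_entranceShift hA _ hF, hQ, lintegral_map hm (measurable_entrancePos hA)]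
  -- The event `T₁ = k` is determined by time `k`, so the fixed-time Markov property applies on each
  -- piece. The pieces reassemble to the integrand at the entrance position, with value `0` at `†`.
  simp_rw [fun k => pathKernel_inter_shift P x k (measurableSet_piLE_entranceTime_eq hA k) hF,
    ← fun k => lintegral_indicator (μ := pathKernel P x) (measurableSet_entranceTime_eq hA k)
      (fun y => pathKernel P (y k) F)]
  rw [← lintegral_tsum fun k =>
    ((hmk k).indicator (measurableSet_entranceTime_eq hA k)).aemeasurable]
  refine lintegral_congr fun y => ?_
  by_cases h : entranceTime A y = ⊤
  · rw [entrancePos_of_eq_top h]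
    simp [h]
  · obtain ⟨k, hk⟩ := ENat.ne_top_iff_exists.1 h
    obtain ⟨hm, hp⟩ := entrancePos_of_eq hk.symm
    rw [hp, tsum_eq_single k]
    · simp [← hk]
    · intro j hj
      refine Set.indicator_of_notMem ?_ _
      rw [Set.mem_ofPred_eq, ← hk]
      exact_mod_cast hj.symm

end EntranceShift

/-! ### The tower over the entrance chain: properness, invariance, entrance law -/

section Tower

variable {X : Type*} [MeasurableSpace X] (P : Kernel X X) [IsMarkovKernel P] {A : Set X}

theorem pathMeasureOn_apply (ν : Measure A) {F : Set (ℕ → X)} (hF : MeasurableSet F) :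
    pathMeasureOn P ν F = ∫⁻ x : A, pathKernel P x F ∂ν := by
  rw [pathMeasureOn, pathMeasure_apply P _ hF,
    lintegral_map ((pathKernel P).measurable_coe hF) measurable_subtype_coe]

theorem ae_pathMeasureOn {ν : Measure A} {p : (ℕ → X) → Prop}
    (h : ∀ᵐ y ∂(pathMeasureOn P ν), p y) : ∀ᵐ x : A ∂ν, ∀ᵐ y ∂(pathKernel P x), p y :=
  ae_of_ae_map measurable_subtype_coe.aemeasurable
    (Measure.ae_ae_of_ae_bind (pathKernel P).aemeasurable h)

theorem pathMeasureOn_zero_mem (hA : MeasurableSet A) (ν : Measure A) {C : Set A}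
    (hC : MeasurableSet C) : pathMeasureOn P ν {y | y 0 ∈ ((↑) '' C : Set X)} = ν C := by
  rw [pathMeasureOn, pathMeasure_zero P _ (hA.subtype_image hC),
    Measure.map_apply measurable_subtype_coe (hA.subtype_image hC),
    Set.preimage_image_eq _ Subtype.val_injective]

/-- Invariance identifies the law after one step only on `A`. That is enough for an integrand
extended by zero, whatever mass sits at `†`. -/
theorem lintegral_elim_entranceKernel {hA : MeasurableSet A} {ν : Measure A}
    (hν : IsEntranceInvariant P hA ν) {g : A → ℝ≥0∞} (hg : Measurable g) :
    ∫⁻ x, ∫⁻ z, Sum.elim g (fun _ => 0) z ∂(entranceKernel P hA (Sum.inl x)) ∂ν =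
      ∫⁻ x, g x ∂ν := by
  have hge : Measurable (Sum.elim g (fun _ : Unit => (0 : ℝ≥0∞))) := hg.sumElim measurable_const
  have hQm : Measurable fun x : A => entranceKernel P hA (Sum.inl x) :=
    (entranceKernel P hA).measurable.comp measurable_inl
  set κ := ν.bind fun x => entranceKernel P hA (Sum.inl x) with hκ
  have hemb : MeasurableEmbedding (Sum.inl : A → A ⊕ Unit) :=
    ⟨Sum.inl_injective, measurable_inl, fun _ h => h.inl_image⟩
  have h1 : ν.map Sum.inl = κ.restrict (Set.range Sum.inl) := by
    rw [← hemb.map_comap]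
    congr 1
    ext B hB
    rw [hemb.comap_apply, hκ, Measure.bind_apply (hemb.measurableSet_image.2 hB) hQm.aemeasurable,
      hν B hB]
  rw [← Measure.lintegral_bind hQm.aemeasurable hge.aemeasurable, ← hκ]
  have h2 : ∫⁻ z, Sum.elim g (fun _ => 0) z ∂κ =
      ∫⁻ z in Set.range Sum.inl, Sum.elim g (fun _ => 0) z ∂κ := by
    rw [← lintegral_indicator hemb.measurableSet_range]
    refine lintegral_congr fun z => ?_
    rcases z with z | z
    · rw [Set.indicator_of_mem (Set.mem_range_self z)]
    · rw [Set.indicator_of_notMem (by simp)]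
      rfl
  rw [h2, ← h1, lintegral_map hge measurable_inl]
  rfl

/-- The path measure started under an invariant measure of the entrance chain is preserved when
paths are seen from their first entrance time on. -/
theorem measurePreserving_entranceShift {hA : MeasurableSet A} {ν : Measure A}
    (hT : pathMeasureOn P ν {y | entranceTime A y = ⊤} = 0) (hν : IsEntranceInvariant P hA ν) :
    MeasurePreserving (entranceShift A) (pathMeasureOn P ν) (pathMeasureOn P ν) := by
  refine ⟨measurable_entranceShift hA, Measure.ext fun F hF => ?_⟩
  have hm := measurable_entranceShift hA hF
  rw [Measure.map_apply (measurable_entranceShift hA) hF]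
  have h1 : pathMeasureOn P ν (entranceShift A ⁻¹' F) =
      pathMeasureOn P ν ({y | entranceTime A y ≠ ⊤} ∩ entranceShift A ⁻¹' F) := by
    refine measure_congr ?_
    filter_upwards [measure_eq_zero_iff_ae_notMem.1 hT] with y hy
    exact propext ⟨fun h => ⟨hy, h⟩, fun h => h.2⟩
  have hTc : MeasurableSet {y : ℕ → X | entranceTime A y ≠ ⊤} :=
    (measurableSet_entranceTime_eq_top hA).compl
  rw [h1, pathMeasureOn_apply P ν (hTc.inter hm),
    pathMeasureOn_apply P ν hF]
  have h2 := fun x : A => pathKernel_entranceShift P hA x hF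
  refine (lintegral_congr h2).trans (lintegral_elim_entranceKernel P hν ?_)
  exact ((pathKernel P).measurable_coe hF).comp measurable_subtype_coe

theorem occupationMeasure_eq_sum (hA : MeasurableSet A) (ν : Measure A) :
    occupationMeasure P hA ν = Measure.sum fun k : ℕ =>
      ((pathMeasureOn P ν).restrict {y | (k : ℕ∞) < entranceTime A y}).map fun y => y k := by
  classical
  ext B hB
  have hm : ∀ k : ℕ, MeasurableSet {y : ℕ → X | (k : ℕ∞) < entranceTime A y ∧ y k ∈ B} :=
    fun k => (measurableSet_lt_entranceTime hA k).inter (measurable_pi_apply k hB)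
  rw [occupationMeasure_apply P hA ν hB, Measure.sum_apply _ hB]
  simp only [visits]
  rw [lintegral_tsum fun k => (Measurable.ite (hm k) measurable_const
    measurable_const).aemeasurable]
  refine tsum_congr fun k => ?_
  have hk : MeasurableSet ((fun y : ℕ → X => y k) ⁻¹' B) := measurable_pi_apply k hB
  rw [Measure.map_apply (measurable_pi_apply k) hB, Measure.restrict_apply hk]
  have : (fun y : ℕ → X => if (k : ℕ∞) < entranceTime A y ∧ y k ∈ B then (1 : ℝ≥0∞) else 0) =
      {y : ℕ → X | (k : ℕ∞) < entranceTime A y ∧ y k ∈ B}.indicator 1 := by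
    ext y
    simp [Set.indicator_apply]
  rw [this, lintegral_indicator_one (hm k)]
  congr 1
  ext y
  exact and_comm

/-- The path measure started under the occupation measure is the tower of the path measure started
under `ν` over its first entrance time. -/
theorem pathMeasure_occupationMeasure (hA : MeasurableSet A) (ν : Measure A) {F : Set (ℕ → X)}
    (hF : MeasurableSet F) :
    pathMeasure P (occupationMeasure P hA ν) F =
      ∑' k : ℕ, pathMeasureOn P ν ({y | (k : ℕ∞) < entranceTime A y} ∩ shift^[k] ⁻¹' F) := by
  rw [pathMeasure_apply P _ hF, occupationMeasure_eq_sum, lintegral_sum_measure]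
  refine tsum_congr fun k => ?_
  rw [lintegral_map ((pathKernel P).measurable_coe hF) (measurable_pi_apply k)]
  exact (pathMeasure_inter_shift P _ k (measurableSet_piLE_lt_entranceTime hA k) hF).symm

/-- Almost sure statements under `P_μ` are obtained by checking, under `P_ν`, every shift of a path
before its first entrance. -/
theorem pathMeasure_occupationMeasure_eq_zero (hA : MeasurableSet A) {ν : Measure A}
    {F : Set (ℕ → X)} (hF : MeasurableSet F)
    (h : ∀ᵐ y ∂(pathMeasureOn P ν), ∀ k : ℕ, (k : ℕ∞) < entranceTime A y → shift^[k] y ∉ F) :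
    pathMeasure P (occupationMeasure P hA ν) F = 0 := by
  rw [pathMeasure_occupationMeasure P hA ν hF, ENNReal.tsum_eq_zero]
  intro k
  rw [measure_eq_zero_iff_ae_notMem]
  filter_upwards [h] with y hy hk
  exact hy k hk.1 hk.2

/-- The shift preserves the path measure started under the occupation measure. -/
theorem measurePreserving_shift {hA : MeasurableSet A} {ν : Measure A}
    (hT : pathMeasureOn P ν {y | entranceTime A y = ⊤} = 0) (hν : IsEntranceInvariant P hA ν) :
    MeasurePreserving shift (pathMeasure P (occupationMeasure P hA ν))
      (pathMeasure P (occupationMeasure P hA ν)) := by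
  refine ⟨measurable_shift, Measure.ext fun F hF => ?_⟩
  have hF' := measurable_shift hF
  rw [Measure.map_apply measurable_shift hF, pathMeasure_occupationMeasure P hA ν hF,
    pathMeasure_occupationMeasure P hA ν hF']
  set ρ := pathMeasureOn P ν
  -- One step up from level `k` leads either to level `k + 1` or to the entrance `T₁ = k + 1`.
  have h1 : ∀ k : ℕ, ρ ({y | (k : ℕ∞) < entranceTime A y} ∩ shift^[k] ⁻¹' (shift ⁻¹' F)) =
      ρ ({y | ((k + 1 : ℕ) : ℕ∞) < entranceTime A y} ∩ shift^[k + 1] ⁻¹' F) +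
        ρ ({y | entranceTime A y = (k + 1 : ℕ)} ∩ shift^[k + 1] ⁻¹' F) := by
    intro k
    rw [← measure_union]
    · congr 1
      ext y
      simp only [Set.mem_inter_iff, Set.mem_ofPred_eq, Set.mem_preimage, Set.mem_union,
        Function.iterate_succ_apply', ← or_and_right]
      refine and_congr_left fun _ => ?_
      rw [← ENat.add_one_le_iff (ENat.natCast_ne_top k), le_iff_lt_or_eq]
      push_cast
      exact or_congr_right eq_comm
    · refine Set.disjoint_left.2 fun y hi hj => ?_
      have h1 : ((k + 1 : ℕ) : ℕ∞) < entranceTime A y := hi.1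
      have h2 : entranceTime A y = (k + 1 : ℕ) := hj.1
      exact h1.ne' h2
    · exact (measurableSet_entranceTime_eq hA _).inter (measurable_iterate_shift _ hF)
  -- The entrance terms add up to `ρ (entranceShift A ⁻¹' F) = ρ F`, which is the missing level-zero
  -- term. Nothing is subtracted, so infinite measures cause no trouble.
  have h2 : ∑' k : ℕ, ρ ({y | entranceTime A y = (k + 1 : ℕ)} ∩ shift^[k + 1] ⁻¹' F) = ρ F := by
    rw [← measure_preimage_entranceShift hA hT hF]
    exact (measurePreserving_entranceShift P hT hν).measure_preimage hF.nullMeasurableSet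
  rw [tsum_congr h1, ENNReal.tsum_add, h2]
  conv_rhs => rw [tsum_eq_zero_add' ENNReal.summable]
  rw [add_comm]
  congr 2
  ext y
  simp [entranceTime_pos]

/-- Almost every path started under `ν` enters `A` from `Aᶜ` infinitely often. -/
theorem ae_iterate_entranceTime_ne_top {hA : MeasurableSet A} {ν : Measure A}
    (hT : pathMeasureOn P ν {y | entranceTime A y = ⊤} = 0) (hν : IsEntranceInvariant P hA ν) :
    ∀ᵐ y ∂(pathMeasureOn P ν), ∀ n, entranceTime A ((entranceShift A)^[n] y) ≠ ⊤ := by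
  rw [ae_all_iff]
  intro n
  exact ((measurePreserving_entranceShift P hT hν).iterate n).quasiMeasurePreserving.ae
    (measure_eq_zero_iff_ae_notMem.1 hT)

/-- Each entrance at `k` exhibits a visit to `Aᶜ` at `k - 1` and one to `A` at `k`; almost surely
there are infinitely many entrances. -/
theorem isProper_of_invariant {hA : MeasurableSet A} {ν : Measure A}
    (hT : pathMeasureOn P ν {y | entranceTime A y = ⊤} = 0) (hν : IsEntranceInvariant P hA ν) :
    IsProper P A ν := by
  have h := ae_pathMeasureOn P (ae_iterate_entranceTime_ne_top P hT hν)
  refine measure_mono_null ?_ (ae_iff.1 h)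
  rintro x hx hx'
  refine hx ?_
  have hu : {y : ℕ → X | (∃ᶠ k in atTop, y k ∈ A) ∧ (∃ᶠ k in atTop, y k ∈ Aᶜ)}
      =ᵐ[pathKernel P x] Set.univ := by
    rw [eventuallyEq_univ]
    filter_upwards [hx'] with y hy
    constructor
    · rw [frequently_atTop]
      intro n
      obtain ⟨k, hk, -, -, -, hk'⟩ := exists_iterate_entranceShift hy n
      exact ⟨k, by omega, hk'⟩
    · rw [frequently_atTop]
      intro n
      obtain ⟨k, hk, -, -, hk', -⟩ := exists_iterate_entranceShift hy n
      exact ⟨k - 1, by omega, hk'⟩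
  exact (measure_congr hu).trans measure_univ

theorem pathKernel_one (x : X) {B : Set X} (hB : MeasurableSet B) :
    pathKernel P x {y | y 1 ∈ B} = P x B := by
  rw [← pathKernel_map_one P x, Measure.map_apply (measurable_pi_apply 1) hB]
  rfl

theorem invariant_occupationMeasure {hA : MeasurableSet A} {ν : Measure A}
    (hT : pathMeasureOn P ν {y | entranceTime A y = ⊤} = 0) (hν : IsEntranceInvariant P hA ν) :
    P.Invariant (occupationMeasure P hA ν) := by
  refine Measure.ext fun B hB => ?_
  have h0 : MeasurableSet {y : ℕ → X | y 0 ∈ B} := measurable_pi_apply 0 hB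
  have h1 : MeasurableSet {y : ℕ → X | y 1 ∈ B} := measurable_pi_apply 1 hB
  rw [Measure.bind_apply hB P.aemeasurable]
  simp_rw [← fun x => pathKernel_one P x hB]
  rw [← pathMeasure_apply P _ h1, ← pathMeasure_zero P _ hB]
  exact (measurePreserving_shift P hT hν).measure_preimage h0.nullMeasurableSet

/-- At level `k` of the tower the event says that `T₁ = k + 1` with entrance position in `C`.
Summing over `k` gives the `ρ`-measure of the preimage of `{y 0 ∈ C}` under `entranceShift A`. -/
theorem pathMeasure_entrance_eq {hA : MeasurableSet A} {ν : Measure A}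
    (hT : pathMeasureOn P ν {y | entranceTime A y = ⊤} = 0) (hν : IsEntranceInvariant P hA ν)
    {C : Set A} (hC : MeasurableSet C) :
    pathMeasure P (occupationMeasure P hA ν)
      ({y | y 0 ∈ Aᶜ} ∩ {y | y 1 ∈ ((↑) '' C : Set X)}) = ν C := by
  have hC' : MeasurableSet ((↑) '' C : Set X) := hA.subtype_image hC
  have h0 : MeasurableSet {y : ℕ → X | y 0 ∈ ((↑) '' C : Set X)} := measurable_pi_apply 0 hC'
  have h1 : MeasurableSet {y : ℕ → X | y 1 ∈ ((↑) '' C : Set X)} := measurable_pi_apply 1 hC'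
  have h2 : MeasurableSet {y : ℕ → X | y 0 ∈ Aᶜ} := measurable_pi_apply 0 hA.compl
  rw [← pathMeasureOn_zero_mem P hA ν hC,
    ← (measurePreserving_entranceShift P hT hν).measure_preimage h0.nullMeasurableSet,
    pathMeasure_occupationMeasure P hA ν (h2.inter h1)]
  rw [measure_preimage_entranceShift hA hT h0]
  refine tsum_congr fun k => ?_
  congr 1
  ext y
  simp only [Set.mem_inter_iff, Set.mem_ofPred_eq, Set.mem_preimage, iterate_shift_apply,
    zero_add]
  rw [add_comm 1 k]
  constructor
  · rintro ⟨hk, hy, hy'⟩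
    refine ⟨entranceTime_eq_iff.2 ⟨⟨by omega, hy, ?_⟩, fun j hj =>
      lt_entranceTime_iff.1 hk j (by omega)⟩, hy'⟩
    obtain ⟨a, -, ha⟩ := hy'
    exact ha ▸ a.2
  · rintro ⟨hk, hy'⟩
    obtain ⟨⟨-, hy, -⟩, hj⟩ := entranceTime_eq_iff.1 hk
    exact ⟨lt_entranceTime_iff.2 fun j hjk => hj j (by omega), hy, hy'⟩

theorem eq_entranceMeasure {hA : MeasurableSet A} {ν : Measure A}
    (hT : pathMeasureOn P ν {y | entranceTime A y = ⊤} = 0) (hν : IsEntranceInvariant P hA ν) :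
    ν = entranceMeasure P A (occupationMeasure P hA ν) := by
  ext C hC
  have hC' : MeasurableSet ((↑) '' C : Set X) := hA.subtype_image hC
  have h1 : MeasurableSet {y : ℕ → X | y 1 ∈ ((↑) '' C : Set X)} := measurable_pi_apply 1 hC'
  rw [← pathMeasure_entrance_eq P hT hν hC, entranceMeasure,
    (MeasurableEmbedding.subtype_coe hA).comap_apply, Measure.bind_apply hC' P.aemeasurable,
    pathMeasure_inter_zero P _ hA.compl h1]
  exact lintegral_congr fun x => pathKernel_one P x hC'

theorem pathMeasure_entranceTime_eq_top {hA : MeasurableSet A} {ν : Measure A}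
    (hT : pathMeasureOn P ν {y | entranceTime A y = ⊤} = 0) :
    pathMeasure P (occupationMeasure P hA ν) {y | entranceTime A y = ⊤} = 0 := by
  refine pathMeasure_occupationMeasure_eq_zero P hA (measurableSet_entranceTime_eq_top hA) ?_
  filter_upwards [measure_eq_zero_iff_ae_notMem.1 hT] with y hy k hk
  exact entranceTime_shift_ne_top hy hk

end Tower

/-! ### Wandering sets and recurrence -/

section Recurrence

/-- If the preimages of `D` under the iterates of a measure preserving map are disjoint, then the
expected number of visits to `G` from `D` is at most the measure of `G`. -/
theorem tsum_measure_inter_preimage_le {Ω : Type*} [MeasurableSpace Ω] {μ : Measure Ω} {f : Ω → Ω}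
    (hf : MeasurePreserving f μ μ) {D G : Set Ω} (hD : MeasurableSet D) (hG : MeasurableSet G)
    (hdisj : ∀ i j, i < j → Disjoint (f^[i] ⁻¹' D) (f^[j] ⁻¹' D)) :
    ∑' k : ℕ, μ (D ∩ f^[k] ⁻¹' G) ≤ μ G := by
  refine ENNReal.tsum_le_of_sum_range_le fun n => ?_
  have hm : ∀ k, MeasurableSet (D ∩ f^[k] ⁻¹' G) := fun k =>
    hD.inter ((hf.iterate k).measurable hG)
  -- Pulling the `k`-th set back by `f^[n - k]` puts all of them inside `f^[n] ⁻¹' G`, where the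
  -- preimages of `D` keep them disjoint.
  have h1 : ∀ k ∈ Finset.range n, μ (D ∩ f^[k] ⁻¹' G) =
      μ (f^[n - k] ⁻¹' D ∩ f^[n] ⁻¹' G) := by
    intro k hk
    have hk' : k + (n - k) = n := Nat.add_sub_cancel' (Finset.mem_range.1 hk).le
    rw [← (hf.iterate (n - k)).measure_preimage (hm k).nullMeasurableSet, Set.preimage_inter,
      ← Set.preimage_comp, ← Function.iterate_add, hk']
  rw [Finset.sum_congr rfl h1, ← measure_biUnion_finset,
    ← (hf.iterate n).measure_preimage hG.nullMeasurableSet]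
  · exact measure_mono (Set.iUnion₂_subset fun _ _ => Set.inter_subset_right)
  · intro i hi j hj hij
    have hi' := Finset.mem_range.1 (Finset.mem_coe.1 hi)
    have hj' := Finset.mem_range.1 (Finset.mem_coe.1 hj)
    refine Disjoint.mono Set.inter_subset_left Set.inter_subset_left ?_
    rcases lt_or_gt_of_ne hij with h | h
    · exact (hdisj (n - j) (n - i) (by omega)).symm
    · exact hdisj (n - i) (n - j) (by omega)
  · exact fun k _ => ((hf.iterate _).measurable hD).inter ((hf.iterate _).measurable hG)

/-- Borel–Cantelli applied to the finite expected number of visits. -/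
theorem ae_mem_imp_not_frequently {Ω : Type*} [MeasurableSpace Ω] {μ : Measure Ω} {f : Ω → Ω}
    (hf : MeasurePreserving f μ μ) {D G : Set Ω} (hD : MeasurableSet D) (hG : MeasurableSet G)
    (hdisj : ∀ i j, i < j → Disjoint (f^[i] ⁻¹' D) (f^[j] ⁻¹' D)) (hfin : μ G < ∞) :
    ∀ᵐ y ∂μ, y ∈ D → ¬ ∃ᶠ k in atTop, f^[k] y ∈ G := by
  have h := measure_setOfPred_frequently_eq_zero (μ := μ)
    (p := fun k y => y ∈ D ∩ f^[k] ⁻¹' G)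
    ((tsum_measure_inter_preimage_le hf hD hG hdisj).trans_lt hfin).ne
  filter_upwards [measure_eq_zero_iff_ae_notMem.1 h] with y hy hyD hyG
  exact hy (hyG.mono fun k hk => ⟨hyD, hk⟩)

variable {X : Type*}

/-- The paths which are outside `C` at time `0` and at their first `n` entrance times into `A`,
all of which are finite. -/
def entranceAvoiding (A : Set X) (C : Set A) : ℕ → Set (ℕ → X)
  | 0 => {y | y 0 ∈ ((↑) '' C : Set X)ᶜ} ∩ Set.univ
  | n + 1 => {y | y 0 ∈ ((↑) '' C : Set X)ᶜ} ∩
      ({y | entranceTime A y ≠ ⊤} ∩ entranceShift A ⁻¹' entranceAvoiding A C n)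

/-- The sequences which avoid `B` up to time `n`. -/
def avoiding {E : Type*} (B : Set E) : ℕ → Set (ℕ → E)
  | 0 => {y | y 0 ∈ Bᶜ} ∩ Set.univ
  | n + 1 => {y | y 0 ∈ Bᶜ} ∩ shift ⁻¹' avoiding B n

theorem mem_avoiding_iff {E : Type*} {B : Set E} {n : ℕ} {y : ℕ → E} :
    y ∈ avoiding B n ↔ ∀ k ≤ n, y k ∉ B := by
  induction n generalizing y with
  | zero => simp [avoiding]
  | succ n ih =>
    simp only [avoiding, Set.mem_inter_iff, Set.mem_ofPred_eq, Set.mem_preimage, ih, shift,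
      Set.mem_compl_iff]
    constructor
    · rintro ⟨h0, h⟩ k hk
      rcases k with _ | k
      · exact h0
      · exact h k (by omega)
    · exact fun h => ⟨h 0 (by omega), fun k hk => h (k + 1) (by omega)⟩

theorem mem_entranceAvoiding {A : Set X} {C : Set A} {y : ℕ → X}
    (hT : ∀ n, entranceTime A ((entranceShift A)^[n] y) ≠ ⊤)
    (hC : ∀ n, (entranceShift A)^[n] y 0 ∉ ((↑) '' C : Set X)) (n : ℕ) :
    y ∈ entranceAvoiding A C n := by
  induction n generalizing y with
  | zero => exact ⟨hC 0, trivial⟩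
  | succ n ih => exact ⟨hC 0, hT 0, ih (fun n => hT (n + 1)) fun n => hC (n + 1)⟩

variable [MeasurableSpace X]

theorem measurableSet_avoiding {E : Type*} [MeasurableSpace E] {B : Set E} (hB : MeasurableSet B)
    (n : ℕ) : MeasurableSet (avoiding B n) := by
  have h0 : MeasurableSet {y : ℕ → E | y 0 ∈ Bᶜ} := measurable_pi_apply 0 hB.compl
  induction n with
  | zero => exact h0.inter MeasurableSet.univ
  | succ n ih => exact h0.inter (measurable_shift ih)

theorem measurableSet_entranceAvoiding {A : Set X} (hA : MeasurableSet A) {C : Set A}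
    (hC : MeasurableSet C) (n : ℕ) : MeasurableSet (entranceAvoiding A C n) := by
  have h0 : MeasurableSet {y : ℕ → X | y 0 ∈ ((↑) '' C : Set X)ᶜ} :=
    measurable_pi_apply 0 (hA.subtype_image hC).compl
  induction n with
  | zero => exact h0.inter MeasurableSet.univ
  | succ n ih =>
    exact h0.inter ((measurableSet_entranceTime_eq_top hA).compl.inter
      (measurable_entranceShift hA ih))

variable (P : Kernel X X) [IsMarkovKernel P] {A : Set X}

/-- One step of the comparison between `Y` seen at its entrances and the entrance chain. It is an
inequality because paths with `T₁ = ⊤` are discarded on the left, while on the right they continue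
at `†`. -/
theorem pathKernel_entranceShift_le (hA : MeasurableSet A) {F : Set (ℕ → X)}
    (hF : MeasurableSet F) {W : Set (ℕ → A ⊕ Unit)} (hW : MeasurableSet W)
    (h : ∀ x : A, pathKernel P x F ≤ pathKernel (entranceKernel P hA) (Sum.inl x) W) (x : A) :
    pathKernel P x ({y | entranceTime A y ≠ ⊤} ∩ entranceShift A ⁻¹' F) ≤
      pathKernel (entranceKernel P hA) (Sum.inl x) (shift ⁻¹' W) := by
  rw [pathKernel_entranceShift P hA x hF, pathKernel_shift _ _ hW]
  refine lintegral_mono fun z => ?_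
  rcases z with z | z
  · exact h z
  · exact zero_le

theorem pathKernel_entranceAvoiding_le (hA : MeasurableSet A) {C : Set A} (hC : MeasurableSet C)
    (n : ℕ) (x : A) :
    pathKernel P x (entranceAvoiding A C n) ≤
      pathKernel (entranceKernel P hA) (Sum.inl x) (avoiding (Sum.inl '' C) n) := by
  have hC' := (hA.subtype_image hC).compl
  have hB : MeasurableSet (Sum.inl '' C : Set (A ⊕ Unit))ᶜ := hC.inl_image.compl
  -- The constraint at time `0` is the same on both sides. The factor `Set.univ` in the base cases
  -- of both definitions lets this serve for the base and the induction step alike.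
  have key : ∀ (x : A) (F : Set (ℕ → X)) (W : Set (ℕ → A ⊕ Unit)),
      pathKernel P x F ≤ pathKernel (entranceKernel P hA) (Sum.inl x) W →
      pathKernel P x ({y | y 0 ∈ ((↑) '' C : Set X)ᶜ} ∩ F) ≤
      pathKernel (entranceKernel P hA) (Sum.inl x)
        ({y | y 0 ∈ (Sum.inl '' C : Set (A ⊕ Unit))ᶜ} ∩ W) := by
    intro x F W h
    rw [pathKernel_inter_zero P x hC', pathKernel_inter_zero _ _ hB]
    by_cases hx : x ∈ C
    · rw [Set.indicator_of_notMem (by simpa using hx)]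
      exact zero_le
    · rw [Set.indicator_of_mem (by simpa using hx), Set.indicator_of_mem (by simpa using hx)]
      exact h
  induction n generalizing x with
  | zero => exact key x _ _ (by simp)
  | succ n ih =>
    exact key x _ _ (pathKernel_entranceShift_le P hA (measurableSet_entranceAvoiding hA hC n)
      (measurableSet_avoiding hC.inl_image n) ih x)

/-- Under a recurrent invariant measure of the entrance chain, almost every path started in a set
of finite measure is again in this set at some entrance time. -/
theorem ae_exists_return {hA : MeasurableSet A} {ν : Measure A}
    (hT : pathMeasureOn P ν {y | entranceTime A y = ⊤} = 0) (hν : IsEntranceInvariant P hA ν)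
    (hrec : IsEntranceRecurrent P hA ν) {C : Set A} (hC : MeasurableSet C) (hfin : ν C < ∞) :
    ∀ᵐ y ∂(pathMeasureOn P ν), y 0 ∈ ((↑) '' C : Set X) →
      ∃ n, (entranceShift A)^[n + 1] y 0 ∈ ((↑) '' C : Set X) := by
  have hC' := hA.subtype_image hC
  set Q := entranceKernel P hA
  -- Paths that start in `C` and are never again in `C` at an entrance. Their probability is at most
  -- that of the entrance chain avoiding `C` during times `1, …, n + 1`, for every `n`.
  set D : Set (ℕ → X) := {y | y 0 ∈ ((↑) '' C : Set X)} ∩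
    ({y | entranceTime A y ≠ ⊤} ∩ entranceShift A ⁻¹' ⋂ n, entranceAvoiding A C n) with hD
  have hI : MeasurableSet (⋂ n, entranceAvoiding A C n) :=
    MeasurableSet.iInter fun n => measurableSet_entranceAvoiding hA hC n
  have hD1 : MeasurableSet ({y | entranceTime A y ≠ ⊤} ∩
      entranceShift A ⁻¹' ⋂ n, entranceAvoiding A C n) :=
    (measurableSet_entranceTime_eq_top hA).compl.inter (measurable_entranceShift hA hI)
  have hDm : MeasurableSet D := (measurable_pi_apply 0 hC').inter hD1
  have hret : ∀ᵐ x : A ∂ν, x ∈ C →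
      pathKernel Q (Sum.inl x) {z | ∃ n : ℕ, 1 ≤ n ∧ z n ∈ Sum.inl '' C} = 1 := by
    have h1 := hrec (Sum.inl '' C) hC.inl_image (by
      rw [withCemetery, Measure.map_apply measurable_inl hC.inl_image,
        Set.preimage_image_eq _ Sum.inl_injective]
      exact hfin)
    filter_upwards [ae_of_ae_map measurable_inl.aemeasurable h1] with x hx hxC
    exact hx (Set.mem_image_of_mem _ hxC)
  have hD0 : pathMeasureOn P ν D = 0 := by
    rw [pathMeasureOn_apply P ν hDm]
    refine (lintegral_congr_ae (g := fun _ => 0) ?_).trans lintegral_zero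
    filter_upwards [hret] with x hx
    rw [hD, pathKernel_inter_zero P x hC']
    by_cases hxC : x ∈ C
    · rw [Set.indicator_of_mem (Set.mem_image_of_mem _ hxC)]
      have hle : ∀ n, pathKernel P x ({y | entranceTime A y ≠ ⊤} ∩
          entranceShift A ⁻¹' ⋂ n, entranceAvoiding A C n) ≤
          pathKernel Q (Sum.inl x) (shift ⁻¹' avoiding (Sum.inl '' C) n) := fun n =>
        pathKernel_entranceShift_le P hA hI (measurableSet_avoiding hC.inl_image n)
          (fun x => (measure_mono (Set.iInter_subset _ n)).trans
            (pathKernel_entranceAvoiding_le P hA hC n x)) x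
      have hmeas : ∀ n, MeasurableSet (shift ⁻¹' avoiding (Sum.inl '' C : Set (A ⊕ Unit)) n) :=
        fun n => measurable_shift (measurableSet_avoiding hC.inl_image n)
      have hanti : Antitone fun n => shift ⁻¹' avoiding (Sum.inl '' C : Set (A ⊕ Unit)) n := by
        intro m n hmn y hy
        rw [Set.mem_preimage, mem_avoiding_iff] at hy ⊢
        exact fun k hk => hy k (hk.trans hmn)
      have hinf := hanti.measure_iInter (μ := pathKernel Q (Sum.inl x))
        (fun n => (hmeas n).nullMeasurableSet) ⟨0, measure_ne_top _ _⟩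
      have hzero : pathKernel Q (Sum.inl x)
          (⋂ n, shift ⁻¹' avoiding (Sum.inl '' C : Set (A ⊕ Unit)) n) = 0 := by
        rw [← prob_compl_eq_one_iff (MeasurableSet.iInter hmeas), ← hx hxC]
        congr 1
        ext z
        simp only [Set.mem_compl_iff, Set.mem_iInter, Set.mem_preimage, mem_avoiding_iff, shift,
          Set.mem_ofPred_eq, not_forall, not_not]
        constructor
        · rintro ⟨n, k, -, hk⟩
          exact ⟨k + 1, by omega, hk⟩
        · rintro ⟨n, hn, hz⟩
          obtain ⟨k, rfl⟩ : ∃ k, n = k + 1 := ⟨n - 1, by omega⟩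
          exact ⟨k, k, le_rfl, hz⟩
      exact le_antisymm ((le_iInf hle).trans (hinf ▸ hzero).le) zero_le
    · rw [Set.indicator_of_notMem (by simpa using hxC)]
  filter_upwards [measure_eq_zero_iff_ae_notMem.1 hD0, ae_iterate_entranceTime_ne_top P hT hν]
    with y hy hyT hy0
  by_contra! hn
  refine hy ⟨hy0, hyT 0, Set.mem_iInter.2 fun n => ?_⟩
  exact mem_entranceAvoiding (fun n => hyT (n + 1)) hn n

/-- Under a recurrent invariant measure of the entrance chain, almost every path started in a set
of finite measure enters `A` through this set infinitely often. -/
theorem ae_frequently_isEntrance {hA : MeasurableSet A} {ν : Measure A}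
    (hT : pathMeasureOn P ν {y | entranceTime A y = ⊤} = 0) (hν : IsEntranceInvariant P hA ν)
    (hrec : IsEntranceRecurrent P hA ν) {C : Set A} (hC : MeasurableSet C) (hfin : ν C < ∞) :
    ∀ᵐ y ∂(pathMeasureOn P ν), y 0 ∈ ((↑) '' C : Set X) →
      ∃ᶠ k in atTop, IsEntrance A y k ∧ y k ∈ ((↑) '' C : Set X) := by
  -- As `entranceShift A` preserves the path law, the single return also holds from every later
  -- entrance on, so returns can be chained.
  have h1 : ∀ᵐ y ∂(pathMeasureOn P ν), ∀ m, (entranceShift A)^[m] y 0 ∈ ((↑) '' C : Set X) →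
      ∃ n, (entranceShift A)^[n + 1] ((entranceShift A)^[m] y) 0 ∈ ((↑) '' C : Set X) := by
    rw [ae_all_iff]
    exact fun m => ((measurePreserving_entranceShift P hT hν).iterate m).quasiMeasurePreserving.ae
      (ae_exists_return P hT hν hrec hC hfin)
  filter_upwards [h1, ae_iterate_entranceTime_ne_top P hT hν] with y hy hyT hy0
  have h2 : ∀ n, ∃ m, n ≤ m ∧ (entranceShift A)^[m] y 0 ∈ ((↑) '' C : Set X) := by
    intro n
    induction n with
    | zero => exact ⟨0, le_rfl, hy0⟩
    | succ n ih =>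
      obtain ⟨m, hm, hmC⟩ := ih
      obtain ⟨j, hj⟩ := hy m hmC
      rw [← Function.iterate_add_apply] at hj
      exact ⟨j + 1 + m, by omega, hj⟩
  rw [frequently_atTop]
  intro n
  -- The bound `n + 1` excludes the iterate `0`, whose starting point need not be an entrance.
  obtain ⟨m, hm, hmC⟩ := h2 (n + 1)
  obtain ⟨m, rfl⟩ : ∃ j, m = j + 1 := ⟨m - 1, by omega⟩
  obtain ⟨k, hk, hk1, hk2⟩ := exists_iterate_entranceShift hyT m
  refine ⟨k, by omega, hk2, ?_⟩
  rwa [hk1, iterate_shift_apply, zero_add] at hmC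

theorem ae_zero_mem (hA : MeasurableSet A) (ν : Measure A) :
    ∀ᵐ y ∂(pathMeasureOn P ν), y 0 ∈ A := by
  have h : pathMeasureOn P ν {y | y 0 ∈ Aᶜ} = 0 := by
    rw [pathMeasureOn, pathMeasure_zero P _ hA.compl,
      Measure.map_apply measurable_subtype_coe hA.compl]
    simp
  filter_upwards [measure_eq_zero_iff_ae_notMem.1 h] with y hy
  exact not_not.1 hy

theorem ae_exists_frequently_isEntrance {hA : MeasurableSet A} {ν : Measure A} [SigmaFinite ν]
    (hT : pathMeasureOn P ν {y | entranceTime A y = ⊤} = 0) (hν : IsEntranceInvariant P hA ν)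
    (hrec : IsEntranceRecurrent P hA ν) :
    ∀ᵐ y ∂(pathMeasure P (occupationMeasure P hA ν)), ∃ i,
      ∃ᶠ k in atTop, IsEntrance A y k ∧ y k ∈ ((↑) '' spanningSets ν i : Set X) := by
  have hm : MeasurableSet {y : ℕ → X | ∃ i,
      ∃ᶠ k in atTop, IsEntrance A y k ∧ y k ∈ ((↑) '' spanningSets ν i : Set X)} := by
    have : {y : ℕ → X | ∃ i, ∃ᶠ k in atTop, IsEntrance A y k ∧
        y k ∈ ((↑) '' spanningSets ν i : Set X)} = ⋃ i, ⋂ n : ℕ, ⋃ k : ℕ, ⋃ _ : n ≤ k,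
        ({y | IsEntrance A y k} ∩ (fun y : ℕ → X => y k) ⁻¹' ((↑) '' spanningSets ν i : Set X)) := by
      ext y
      simp only [frequently_atTop, Set.mem_ofPred_eq, Set.mem_iUnion, Set.mem_iInter,
        Set.mem_inter_iff, Set.mem_preimage, exists_prop]
    rw [this]
    refine MeasurableSet.iUnion fun i => MeasurableSet.iInter fun n => MeasurableSet.iUnion fun k =>
      MeasurableSet.iUnion fun _ => MeasurableSet.inter ?_ ?_
    · exact Filtration.piLE.le k _ (measurableSet_piLE_isEntrance hA le_rfl)
    · exact measurable_pi_apply k (hA.subtype_image (measurableSet_spanningSets ν i))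
  refine ae_iff.2 (pathMeasure_occupationMeasure_eq_zero P hA hm.compl ?_)
  have h1 : ∀ᵐ y ∂(pathMeasureOn P ν), ∀ i, y 0 ∈ ((↑) '' spanningSets ν i : Set X) →
      ∃ᶠ k in atTop, IsEntrance A y k ∧ y k ∈ ((↑) '' spanningSets ν i : Set X) := by
    rw [ae_all_iff]
    exact fun i => ae_frequently_isEntrance P hT hν hrec (measurableSet_spanningSets ν i)
      (measure_spanningSets_lt_top ν i)
  filter_upwards [h1, ae_zero_mem P hA ν] with y hy hy0 j _
  refine not_not.2 ?_
  obtain ⟨i, hi⟩ := Set.mem_iUnion.1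
    ((iUnion_spanningSets ν).symm ▸ Set.mem_univ (⟨y 0, hy0⟩ : A))
  refine ⟨i, frequently_atTop.2 fun n => ?_⟩
  -- Seen from time `j`, the entrance at `k` occurs at `k - j ≥ n`; the extra `1` gives the `j < k`
  -- needed to keep it an entrance.
  obtain ⟨k, hk, hk1, hk2⟩ := frequently_atTop.1 (hy i ⟨_, hi, rfl⟩) (n + j + 1)
  refine ⟨k - j, by omega, hk1.shift (by omega), ?_⟩
  rwa [iterate_shift_apply, Nat.sub_add_cancel (by omega)]

theorem isRecurrent_occupationMeasure {hA : MeasurableSet A} {ν : Measure A} [SigmaFinite ν]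
    (hT : pathMeasureOn P ν {y | entranceTime A y = ⊤} = 0) (hν : IsEntranceInvariant P hA ν)
    (hrec : IsEntranceRecurrent P hA ν) : IsRecurrent P (occupationMeasure P hA ν) := by
  intro B hB _
  set R : Set (ℕ → X) := {y | ∃ n : ℕ, 1 ≤ n ∧ y n ∈ B} with hR
  have hRm : MeasurableSet R := by
    have : R = ⋃ n : ℕ, ⋃ _ : 1 ≤ n, (fun y : ℕ → X => y n) ⁻¹' B := by
      ext y
      simp [hR]
    rw [this]
    exact MeasurableSet.iUnion fun n => MeasurableSet.iUnion fun _ => measurable_pi_apply n hB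
  have h0 : MeasurableSet {y : ℕ → X | y 0 ∈ B} := measurable_pi_apply 0 hB
  set D : Set (ℕ → X) := {y | y 0 ∈ B} ∩ Rᶜ with hD
  have hDm : MeasurableSet D := h0.inter hRm.compl
  -- A path in both preimages would be in `B` at time `j`, although it does not return to `B` after
  -- time `i`.
  have hdisj : ∀ i j, i < j → Disjoint (shift^[i] ⁻¹' D) (shift^[j] ⁻¹' D) := by
    intro i j hij
    refine Set.disjoint_left.2 fun y hi hj => hi.2 ⟨j - i, by omega, ?_⟩
    have h1 : shift^[j] y 0 ∈ B := hj.1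
    rw [iterate_shift_apply] at h1 ⊢
    convert h1 using 2
    omega
  have hC := fun i => measurableSet_spanningSets ν i
  have hae : ∀ᵐ y ∂(pathMeasure P (occupationMeasure P hA ν)), ∀ i, y ∈ D →
      ¬ ∃ᶠ k in atTop, shift^[k] y ∈
        {y : ℕ → X | y 0 ∈ Aᶜ} ∩ {y | y 1 ∈ ((↑) '' spanningSets ν i : Set X)} := by
    rw [ae_all_iff]
    intro i
    refine ae_mem_imp_not_frequently (measurePreserving_shift P hT hν) hDm ?_ hdisj ?_
    · have h1 : MeasurableSet {y : ℕ → X | y 0 ∈ Aᶜ} := measurable_pi_apply 0 hA.compl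
      exact h1.inter (measurable_pi_apply 1 (hA.subtype_image (hC i)))
    · rw [pathMeasure_entrance_eq P hT hν (hC i)]
      exact measure_spanningSets_lt_top ν i
  have hD0 : ∀ᵐ y ∂(pathMeasure P (occupationMeasure P hA ν)), y ∉ D := by
    filter_upwards [hae, ae_exists_frequently_isEntrance P hT hν hrec] with y hy hyE hyD
    obtain ⟨i, hi⟩ := hyE
    refine hy i hyD (frequently_atTop.2 fun n => ?_)
    -- An entrance at `k` is a visit of the shifted path to the crossing event at time `k - 1`.
    obtain ⟨k, hk, ⟨hk0, hk1, -⟩, hk2⟩ := frequently_atTop.1 hi (n + 1)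
    refine ⟨k - 1, by omega, ?_, ?_⟩
    · rw [Set.mem_ofPred_eq, iterate_shift_apply, zero_add]
      exact hk1
    · rw [Set.mem_ofPred_eq, iterate_shift_apply, add_comm, Nat.sub_add_cancel hk0]
      exact hk2
  rw [← measure_eq_zero_iff_ae_notMem, pathMeasure_apply P _ hDm, lintegral_eq_zero_iff
    ((pathKernel P).measurable_coe hDm)] at hD0
  filter_upwards [hD0] with x hx hxB
  rw [← prob_compl_eq_zero_iff hRm]
  have h1 : pathKernel P x D = 0 := hx
  rwa [hD, pathKernel_inter_zero P x hB, Set.indicator_of_mem hxB] at h1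

end Recurrence

/-! ### Lévy's 0-1 law and ergodicity -/

section Ergodicity

theorem pathKernel_ae_zero_mem {E : Type*} [MeasurableSpace E] (P : Kernel E E) [IsMarkovKernel P]
    {x : E} {S : Set E} (hS : MeasurableSet S) (hx : x ∈ S) :
    ∀ᵐ y ∂(pathKernel P x), y 0 ∈ S := by
  have h := pathKernel_inter_zero P x hS.compl Set.univ
  rw [Set.indicator_of_notMem (by simpa using hx), Set.inter_univ] at h
  filter_upwards [measure_eq_zero_iff_ae_notMem.1 h] with y hy
  exact not_not.1 hy

theorem preimage_iterate_shift {E : Type*} {F : Set (ℕ → E)} (hF : shift ⁻¹' F = F) (k : ℕ) :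
    shift^[k] ⁻¹' F = F :=
  Function.IsFixedPt.preimage_iterate hF k

/-- The probability of a shift-invariant event, evaluated along a path of the chain, converges to
the indicator of the event. -/
theorem tendsto_pathKernel_indicator {E : Type*} [MeasurableSpace E] (P : Kernel E E)
    [IsMarkovKernel P] {F : Set (ℕ → E)} (hF : MeasurableSet F) (hinv : shift ⁻¹' F = F) (x : E) :
    ∀ᵐ y ∂(pathKernel P x), Tendsto (fun n => (pathKernel P (y n)).real F) atTop
      (nhds (F.indicator (fun _ => (1 : ℝ)) y)) := by
  set g : (ℕ → E) → ℝ := F.indicator fun _ => (1 : ℝ) with hg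
  have hgi : Integrable g (pathKernel P x) := (integrable_const 1).indicator hF
  have hsup : (MeasurableSpace.pi : MeasurableSpace (ℕ → E)) ≤
      ⨆ n, Filtration.piLE (X := fun _ : ℕ => E) n := by
    refine iSup_le fun n => le_trans ?_ (le_iSup _ n)
    rintro _ ⟨B, hB, rfl⟩
    rw [Filtration.piLE_eq_comap_frestrictLe]
    exact ⟨{h | h ⟨n, Finset.mem_Iic.2 le_rfl⟩ ∈ B}, measurable_pi_apply _ hB, rfl⟩
  have hgm : StronglyMeasurable[⨆ n, Filtration.piLE (X := fun _ : ℕ => E) n] g :=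
    (stronglyMeasurable_const.indicator hF).mono hsup
  have h1 := hgi.tendsto_ae_condExp hgm
  have h2 : ∀ᵐ y ∂(pathKernel P x), ∀ n : ℕ,
      ((pathKernel P x)[g | Filtration.piLE (X := fun _ : ℕ => E) n]) y =
        (pathKernel P (y n)).real F := by
    rw [ae_all_iff]
    intro n
    -- The conditional probability of `F` given the history is that of the trajectory continuing it.
    -- Since `F` is shift-invariant, only the future after `n` counts, and this is the chain started
    -- at `y n`.
    have h3 := Kernel.condExp_traj (X := fun _ : ℕ => E) (κ := historyKernel P) (Nat.zero_le n)
      (x₀ := fun _ => x) (f := g) hgi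
    filter_upwards [h3] with y hy
    refine hy.trans ?_
    rw [hg, integral_indicator_const _ hF, smul_eq_mul, mul_one, measureReal_def, measureReal_def]
    congr 1
    have h4 := traj_map_shift P n (Preorder.frestrictLe n y)
    have h5 : pathKernel P (y n) = pathKernel P (Preorder.frestrictLe (π := fun _ => E) n y
      ⟨n, Finset.mem_Iic.2 le_rfl⟩) := rfl
    rw [h5, ← h4, Measure.map_apply (measurable_iterate_shift n) hF, preimage_iterate_shift hinv]
  filter_upwards [h1, h2] with y hy1 hy2
  simpa only [hy2] using hy1

variable {X : Type*} [MeasurableSpace X] (P : Kernel X X) [IsMarkovKernel P] {A : Set X}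

/-- Under a recurrent `σ`-finite invariant measure of the entrance chain, shift-invariant events
have probability zero or one from almost every starting point. -/
theorem ae_pathKernel_eq_zero_or_one {hA : MeasurableSet A} {ν : Measure A} [SigmaFinite ν]
    (hT : pathMeasureOn P ν {y | entranceTime A y = ⊤} = 0) (hν : IsEntranceInvariant P hA ν)
    (hrec : IsEntranceRecurrent P hA ν) {F : Set (ℕ → X)} (hF : MeasurableSet F)
    (hinv : shift ⁻¹' F = F) :
    ∀ᵐ x : A ∂ν, pathKernel P x F = 0 ∨ pathKernel P x F = 1 := by
  have hm : Measurable fun x : A => (pathKernel P x).real F :=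
    (((pathKernel P).measurable_coe hF).comp measurable_subtype_coe).ennreal_toReal
  -- From a non-null set of such `x`, the chain would return there infinitely often, so the limit of
  -- `P_{y n}(F)` would lie in this closed interval. But the limit is `0` or `1`.
  have key : ∀ i m : ℕ, ∀ᵐ x : A ∂ν, x ∈ spanningSets ν i →
      (pathKernel P x).real F ∉ Set.Icc (1 / ((m : ℝ) + 1)) (1 - 1 / ((m : ℝ) + 1)) := by
    intro i m
    set C : Set A := spanningSets ν i ∩ {x : A | (pathKernel P x).real F ∈
      Set.Icc (1 / ((m : ℝ) + 1)) (1 - 1 / ((m : ℝ) + 1))}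
    have hC : MeasurableSet C := (measurableSet_spanningSets ν i).inter (hm measurableSet_Icc)
    have hfin : ν C < ∞ :=
      (measure_mono Set.inter_subset_left).trans_lt (measure_spanningSets_lt_top ν i)
    filter_upwards [ae_pathMeasureOn P (ae_frequently_isEntrance P hT hν hrec hC hfin)]
      with x hx hxi hxm
    have hfalse : ∀ᵐ y ∂(pathKernel P (x : X)), False := by
      filter_upwards [hx, tendsto_pathKernel_indicator P hF hinv (x : X),
        pathKernel_ae_zero_mem P (hA.subtype_image hC) (Set.mem_image_of_mem _ ⟨hxi, hxm⟩)]
        with y hy hlim hy0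
      have hmem : F.indicator (fun _ => (1 : ℝ)) y ∈
          Set.Icc (1 / ((m : ℝ) + 1)) (1 - 1 / ((m : ℝ) + 1)) := by
        refine isClosed_Icc.mem_of_frequently_of_tendsto ((hy hy0).mono fun k hk => ?_) hlim
        obtain ⟨a, ha, hak⟩ := hk.2
        rw [← hak]
        exact ha.2
      have hpos : 0 < 1 / ((m : ℝ) + 1) := by positivity
      by_cases hyF : y ∈ F
      · rw [Set.indicator_of_mem hyF] at hmem
        linarith [hmem.2]
      · rw [Set.indicator_of_notMem hyF] at hmem
        linarith [hmem.1]
    exact hfalse.exists.elim fun _ h => h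
  filter_upwards [ae_all_iff.2 fun i => ae_all_iff.2 (key i)] with x hx
  obtain ⟨i, hi⟩ := Set.mem_iUnion.1 ((iUnion_spanningSets ν).symm ▸ Set.mem_univ x)
  by_contra! hne
  have h0 : 0 < (pathKernel P x).real F :=
    ENNReal.toReal_pos hne.1 (measure_ne_top _ _)
  have h1 : (pathKernel P x).real F < 1 := by
    have := (ENNReal.toReal_lt_toReal (measure_ne_top (pathKernel P x) F) ENNReal.one_ne_top).2
      (lt_of_le_of_ne prob_le_one hne.2)
    rwa [ENNReal.toReal_one] at this
  -- A value strictly between `0` and `1` lies in one of the countably many intervals excluded by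
  -- `key`.
  obtain ⟨m, hm'⟩ := exists_nat_one_div_lt (lt_min h0 (sub_pos.2 h1))
  refine hx i m hi ⟨(hm'.trans_le (min_le_left _ _)).le, ?_⟩
  linarith [hm'.trans_le (min_le_right _ _)]

/-- The law of the first two states of the entrance chain. -/
theorem pathMeasure_entranceKernel_pair (hA : MeasurableSet A) (ν : Measure A)
    {S₁ S₂ : Set (A ⊕ Unit)} (hS₁ : MeasurableSet S₁) (hS₂ : MeasurableSet S₂) :
    pathMeasure (entranceKernel P hA) (withCemetery ν) ({z | z 0 ∈ S₁} ∩ {z | z 1 ∈ S₂}) =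
      pathMeasureOn P ν ({y | y 0 ∈ ((↑) '' (Sum.inl ⁻¹' S₁ : Set A) : Set X)} ∩
        entrancePos A ⁻¹' S₂) := by
  have hi : MeasurableSet ((↑) '' (Sum.inl ⁻¹' S₁ : Set A) : Set X) :=
    hA.subtype_image (measurable_inl hS₁)
  have hi' : MeasurableSet {y : ℕ → X | y 0 ∈ ((↑) '' (Sum.inl ⁻¹' S₁ : Set A) : Set X)} :=
    measurable_pi_apply 0 hi
  have h1 : MeasurableSet {z : ℕ → A ⊕ Unit | z 1 ∈ S₂} := measurable_pi_apply 1 hS₂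
  have hp := measurable_entrancePos hA hS₂
  have hpre : ((↑) : A → X) ⁻¹' ((↑) '' (Sum.inl ⁻¹' S₁ : Set A)) = Sum.inl ⁻¹' S₁ :=
    Set.preimage_image_eq _ Subtype.val_injective
  rw [pathMeasure_inter_zero _ _ hS₁ h1, withCemetery, setLIntegral_map hS₁
    ((pathKernel (entranceKernel P hA)).measurable_coe h1) measurable_inl, pathMeasureOn,
    pathMeasure_inter_zero _ _ hi hp, setLIntegral_map hi ((pathKernel P).measurable_coe hp)
    measurable_subtype_coe, hpre]
  refine lintegral_congr fun x => ?_
  rw [pathKernel_one _ _ hS₂]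
  exact Measure.map_apply (measurable_entrancePos hA) hS₂

theorem isErgodic_occupationMeasure {hA : MeasurableSet A} {ν : Measure A} [SigmaFinite ν]
    (hT : pathMeasureOn P ν {y | entranceTime A y = ⊤} = 0) (hν : IsEntranceInvariant P hA ν)
    (hrec : IsEntranceRecurrent P hA ν) (herg : IsEntranceErgodic P hA ν) :
    IsErgodic P (occupationMeasure P hA ν) := by
  refine { measurePreserving_shift P hT hν with aeconst_set := fun F hF hinv => ?_ }
  set C : Set A := {x : A | pathKernel P x F = 1} with hCdef
  have hC : MeasurableSet C :=
    ((pathKernel P).measurable_coe hF).comp measurable_subtype_coe (measurableSet_singleton 1)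
  have hC' : MeasurableSet ((↑) '' C : Set X) := hA.subtype_image hC
  have hB : MeasurableSet (Sum.inl '' C : Set (A ⊕ Unit)) := hC.inl_image
  have h01 := ae_pathKernel_eq_zero_or_one P hT hν hrec hF hinv
  have hm : ∀ {S : Set X}, MeasurableSet S → MeasurableSet {y : ℕ → X | y 0 ∈ S} :=
    fun hS => measurable_pi_apply 0 hS
  have hE1 : pathMeasureOn P ν ({y | y 0 ∈ ((↑) '' C : Set X)} ∩ Fᶜ) = 0 := by
    rw [pathMeasureOn_apply P ν ((hm hC').inter hF.compl)]
    refine (lintegral_congr fun x => ?_).trans lintegral_zero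
    rw [pathKernel_inter_zero P x hC']
    by_cases hx : x ∈ C
    · rw [Set.indicator_of_mem (Set.mem_image_of_mem _ hx), prob_compl_eq_zero_iff hF]
      exact hx
    · rw [Set.indicator_of_notMem (by simpa using hx)]
  have hE2 : pathMeasureOn P ν ({y | y 0 ∈ ((↑) '' C : Set X)ᶜ} ∩ F) = 0 := by
    rw [pathMeasureOn_apply P ν ((hm hC'.compl).inter hF)]
    refine (lintegral_congr_ae (g := fun _ => 0) ?_).trans lintegral_zero
    filter_upwards [h01] with x hx01
    rw [pathKernel_inter_zero P x hC'.compl]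
    by_cases hx : x ∈ C
    · rw [Set.indicator_of_notMem (by simpa using hx)]
    · rw [Set.indicator_of_mem (by simpa using hx)]
      exact hx01.resolve_right hx
  have hiff : ∀ᵐ y ∂(pathMeasureOn P ν), y 0 ∈ ((↑) '' C : Set X) ↔ y ∈ F := by
    filter_upwards [measure_eq_zero_iff_ae_notMem.1 hE1, measure_eq_zero_iff_ae_notMem.1 hE2]
      with y hy1 hy2
    exact ⟨fun h => by_contra fun hF => hy1 ⟨h, hF⟩, fun hF => by_contra fun h => hy2 ⟨h, hF⟩⟩
  -- Apply `hiff` to `y` and to the path from `T₁` on: membership in `F` is the same for both, so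
  -- starting in `C` is equivalent to entering through `C`.
  have hstep : ∀ᵐ y ∂(pathMeasureOn P ν),
      (y 0 ∈ ((↑) '' C : Set X) ↔ entrancePos A y ∈ (Sum.inl '' C : Set (A ⊕ Unit))) := by
    filter_upwards [hiff, (measurePreserving_entranceShift P hT hν).quasiMeasurePreserving.ae hiff,
      measure_eq_zero_iff_ae_notMem.1 hT] with y hy hyS hyT
    obtain ⟨k, hk⟩ := ENat.ne_top_iff_exists.1 hyT
    obtain ⟨hmem, hpos⟩ := entrancePos_of_eq hk.symm
    have hFk : shift^[k] y ∈ F ↔ y ∈ F := by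
      rw [← Set.mem_preimage, preimage_iterate_shift hinv]
    rw [entranceShift_of_eq hk.symm, hFk, iterate_shift_apply, zero_add] at hyS
    rw [hy, ← hyS, hpos]
    simp [hmem]
  -- Invariance of `{z 0 ∈ C}` modulo null sets involves only the first two states of the entrance
  -- chain, so their joint law is all that has to be compared with `Y`.
  have hs : shift ⁻¹' {z : ℕ → A ⊕ Unit | z 0 ∈ Sum.inl '' C}
      =ᵐ[pathMeasure (entranceKernel P hA) (withCemetery ν)] {z | z 0 ∈ Sum.inl '' C} := by
    have hs1 := pathMeasure_entranceKernel_pair P hA ν hB hB.compl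
    have hs2 := pathMeasure_entranceKernel_pair P hA ν hB.compl hB
    rw [Set.preimage_compl, Set.preimage_image_eq _ Sum.inl_injective] at hs2
    rw [Set.preimage_image_eq _ Sum.inl_injective] at hs1
    have hz1 : pathMeasureOn P ν ({y | y 0 ∈ ((↑) '' C : Set X)} ∩
        entrancePos A ⁻¹' (Sum.inl '' C : Set (A ⊕ Unit))ᶜ) = 0 := by
      rw [measure_eq_zero_iff_ae_notMem]
      filter_upwards [hstep] with y hy hy'
      exact hy'.2 (hy.1 hy'.1)
    have hz2 : pathMeasureOn P ν ({y | y 0 ∈ ((↑) '' Cᶜ : Set X)} ∩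
        entrancePos A ⁻¹' (Sum.inl '' C : Set (A ⊕ Unit))) = 0 := by
      rw [measure_eq_zero_iff_ae_notMem]
      filter_upwards [hstep] with y hy hy'
      obtain ⟨a, ha, hay⟩ := hy'.1
      obtain ⟨b, hb, hby⟩ := hy.2 hy'.2
      exact ha (Subtype.val_injective (hby.trans hay.symm) ▸ hb)
    filter_upwards [measure_eq_zero_iff_ae_notMem.1 (hs1.trans hz1),
      measure_eq_zero_iff_ae_notMem.1 (hs2.trans hz2)] with z hz hz'
    exact propext ⟨fun h1 => by_contra fun h0 => hz' ⟨h0, h1⟩,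
      fun h0 => by_contra fun h1 => hz ⟨h0, h1⟩⟩
  have hsm : MeasurableSet {z : ℕ → A ⊕ Unit | z 0 ∈ Sum.inl '' C} := measurable_pi_apply 0 hB
  have hFk : ∀ (k : ℕ) (y : ℕ → X), shift^[k] y ∈ F ↔ y ∈ F := fun k y => by
    rw [← Set.mem_preimage, preimage_iterate_shift hinv]
  rw [eventuallyConst_set]
  -- Ergodicity leaves `C` conull or null for `ν`. By `hiff`, the event `F` has the same alternative
  -- under `P_ν`, and being shift-invariant it keeps it at every level of the tower.
  rcases (show Ergodic _ _ from herg).quasiErgodic.ae_mem_or_ae_notMem₀ hsm.nullMeasurableSet hs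
    with h | h
  · left
    have hν0 : ν Cᶜ = 0 := by
      have h1 := pathMeasure_zero (entranceKernel P hA) (withCemetery ν) hB.compl
      rw [withCemetery, Measure.map_apply measurable_inl hB.compl, Set.preimage_compl,
        Set.preimage_image_eq _ Sum.inl_injective] at h1
      rw [← h1]
      exact ae_iff.1 h
    rw [← pathMeasureOn_zero_mem P hA ν hC.compl] at hν0
    refine ae_iff.2 (pathMeasure_occupationMeasure_eq_zero P hA hF.compl ?_)
    filter_upwards [hiff, measure_eq_zero_iff_ae_notMem.1 hν0, ae_zero_mem P hA ν]
      with y hy hy1 hyA k _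
    refine not_not.2 ((hFk k y).2 (hy.1 ⟨⟨y 0, hyA⟩, ?_, rfl⟩))
    exact by_contra fun h => hy1 ⟨⟨y 0, hyA⟩, h, rfl⟩
  · right
    have hν0 : ν C = 0 := by
      have h1 := pathMeasure_zero (entranceKernel P hA) (withCemetery ν) hB
      rw [withCemetery, Measure.map_apply measurable_inl hB,
        Set.preimage_image_eq _ Sum.inl_injective] at h1
      rw [← h1]
      exact measure_eq_zero_iff_ae_notMem.2 h
    rw [← pathMeasureOn_zero_mem P hA ν hC] at hν0
    refine measure_eq_zero_iff_ae_notMem.1 (pathMeasure_occupationMeasure_eq_zero P hA hF ?_)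
    filter_upwards [hiff, measure_eq_zero_iff_ae_notMem.1 hν0] with y hy hy1 k _ hk
    exact hy1 (hy.2 ((hFk k y).1 hk))

end Ergodicity

end EntranceChain

theorem theorem3p2 {X : Type*} [MeasurableSpace X]
    (P : Kernel X X) [IsMarkovKernel P]
    (A : Set X) (hA : MeasurableSet A) (hne : A.Nonempty)
    (ν : Measure A)
    (hT : pathMeasureOn P ν {y | entranceTime A y = ⊤} = 0)
    (hν : IsEntranceInvariant P hA ν) :
    IsProper P A ν ∧
    P.Invariant (occupationMeasure P hA ν) ∧
    ν = entranceMeasure P A (occupationMeasure P hA ν) ∧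
    pathMeasure P (occupationMeasure P hA ν) {y | entranceTime A y = ⊤} = 0 ∧
    (SigmaFinite ν → IsEntranceRecurrent P hA ν →
      IsRecurrent P (occupationMeasure P hA ν) ∧
      (IsEntranceErgodic P hA ν → IsErgodic P (occupationMeasure P hA ν))) :=
  ⟨isProper_of_invariant P hT hν, invariant_occupationMeasure P hT hν,
    eq_entranceMeasure P hT hν, pathMeasure_entranceTime_eq_top P hT,
    fun _ hrec => ⟨isRecurrent_occupationMeasure P hT hν hrec,
      isErgodic_occupationMeasure P hT hν hrec⟩⟩
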